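/- Let $N\ge 2$ be an integer, let $p>2$, with $p<\frac{2N}{N-2}$ if $N\ge 3$, and let $\Omega\subset\mathbb R^N$ be an unbounded domain (a connected open set) with $0\in\Omega$. Let $\alpha\in L^{N/2}(\mathbb R^N)$ satisfy $\alpha\ge 0$ a.e., $|\alpha|_{L^{N/2}(\mathbb R^N)}>0$ and $$\int_{\mathbb R^N}\alpha(x)\,e^{2|x|}\Bigl(1+|x|^{\frac{N-1}{2}\sigma}\Bigr)\,dx<\infty\quad\text{for some }\sigma\in(1,2].$$ For $x\in\Omega$ put $$r(x)=\sup\{\rho>0 : \exists\,\bar x\in\Omega\text{ such that }x\in B(\bar x,\rho)\text{ and }B(\bar x,\rho)\subset\Omega\}\in(0,\infty],$$ where $B(y,\rho)$ is the open ball with centre $y$ and radius $\rho$, and assume $$\lim_{R\to\infty}\inf\{r(x) : x\in\Omega,\ |x|=R\}=+\infty.\qquad (C_1)$$ For $\varepsilon>0$ let $\Omega_\varepsilon=\{x\in\mathbb R^N : \varepsilon x\in\Omega\}$. Functions in $H^1_0(\Omega_\varepsilon)$, the closure of $C_c^\infty(\Omega_\varepsilon)$ in the $H^1$ norm, are real valued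 and are extended by $0$ to $\mathbb R^N$. Set $$E(u)=\int_{\mathbb R^N}\bigl(|\nabla u|^2+(1+\alpha(x))u^2\bigr)\,dx\in[0,\infty],\qquad V_\varepsilon=\{u\in H^1_0(\Omega_\varepsilon) : |u|_{L^p}=1\},$$ $$m_\varepsilon=\inf\{E(u) : u\in V_\varepsilon\},\qquad m=\inf\Bigl\{\int_{\mathbb R^N}\bigl(|\nabla u|^2+u^2\bigr)\,dx : u\in H^1(\mathbb R^N),\ |u|_{L^p}=1\Bigr\}.$$ Then for every $\varepsilon>0$ one has $m_\varepsilon=m$, and the infimum defining $m_\varepsilon$ is not attained: there is no $u\in V_\varepsilon$ with $E(u)=m_\varepsilon$. -/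

import Mathlib

open MeasureTheory Filter Topology Set
open scoped ENNReal ContDiff

namespace Concentrating

/-- Test functions on the open set `D`: real functions of class `C^∞` on `ℝ^N` whose support is
compact and contained in `D`. -/
def IsTestFunction {N : ℕ} (D : Set (EuclideanSpace ℝ (Fin N)))
    (φ : EuclideanSpace ℝ (Fin N) → ℝ) : Prop :=
  ContDiff ℝ ∞ φ ∧ HasCompactSupport φ ∧ tsupport φ ⊆ D

/-- `G` is the weak (distributional) gradient of `u` on `ℝ^N`:
`∫ u ∇φ = - ∫ φ G` for all test functions `φ`. -/
def HasWeakGradient {N : ℕ} (u : EuclideanSpace ℝ (Fin N) → ℝ)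
    (G : EuclideanSpace ℝ (Fin N) → EuclideanSpace ℝ (Fin N)) : Prop :=
  LocallyIntegrable u volume ∧ LocallyIntegrable G volume ∧
    ∀ φ : EuclideanSpace ℝ (Fin N) → ℝ, IsTestFunction univ φ →
      ∫ x, u x • gradient φ x = - ∫ x, φ x • G x

open Classical in
/-- The weak gradient of `u`, which is unique up to null sets
(and `0` if `u` has no weak gradient). -/
noncomputable def weakGradient {N : ℕ} (u : EuclideanSpace ℝ (Fin N) → ℝ) :
    EuclideanSpace ℝ (Fin N) → EuclideanSpace ℝ (Fin N) :=
  if h : ∃ G, HasWeakGradient u G then h.choose else 0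

/-- `u` is (a representative of) an element of the Sobolev space `H^1(ℝ^N)`. -/
def MemH1 {N : ℕ} (u : EuclideanSpace ℝ (Fin N) → ℝ) : Prop :=
  MemLp u 2 volume ∧ ∃ G, HasWeakGradient u G ∧ MemLp G 2 volume

/-- `u` is (a representative of) the extension by zero to `ℝ^N` of an element of `H^1_0(D)`, the
closure of the test functions on `D` in the `H^1` norm. -/
def MemH10 {N : ℕ} (D : Set (EuclideanSpace ℝ (Fin N)))
    (u : EuclideanSpace ℝ (Fin N) → ℝ) : Prop :=
  MemH1 u ∧ ∀ δ : ℝ≥0∞, 0 < δ → ∃ φ : EuclideanSpace ℝ (Fin N) → ℝ, IsTestFunction D φ ∧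
    eLpNorm (fun x => u x - φ x) 2 volume < δ ∧
    eLpNorm (fun x => weakGradient u x - gradient φ x) 2 volume < δ

/-- The rescaled set `D_ε = {x : ε x ∈ D}`. -/
def rescale {N : ℕ} (D : Set (EuclideanSpace ℝ (Fin N))) (ε : ℝ) :
    Set (EuclideanSpace ℝ (Fin N)) :=
  {x | ε • x ∈ D}

/-- `r(x)`: the supremum in `[0, ∞]` of the radii of the balls that contain `x`, are
contained in `Ω`, and have their centre in `Ω`. -/
noncomputable def innerRadius {N : ℕ} (Ω : Set (EuclideanSpace ℝ (Fin N)))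
    (x : EuclideanSpace ℝ (Fin N)) : ℝ≥0∞ :=
  sSup (ENNReal.ofReal ''
    {ρ : ℝ | 0 < ρ ∧ ∃ c ∈ Ω, x ∈ Metric.ball c ρ ∧ Metric.ball c ρ ⊆ Ω})

/-- The domain enlarges at infinity: `inf {r(x) : x ∈ Ω, |x| = R} → ∞` as `R → ∞`. -/
def EnlargesAtInfinity {N : ℕ} (Ω : Set (EuclideanSpace ℝ (Fin N))) : Prop :=
  Tendsto (fun R : ℝ => sInf (innerRadius Ω '' {x | x ∈ Ω ∧ ‖x‖ = R})) atTop (𝓝 ⊤)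

/-- `E(u) = ∫ (|∇u|² + (1 + α) u²)`, as an element of `[0, ∞]`. (In dimension `2`, a potential
`α ∈ L^1` does not force `∫ α u²` to be finite for all `u ∈ H^1`.) -/
noncomputable def energy {N : ℕ} (α : EuclideanSpace ℝ (Fin N) → ℝ)
    (u : EuclideanSpace ℝ (Fin N) → ℝ) : ℝ≥0∞ :=
  ∫⁻ x, ENNReal.ofReal (‖weakGradient u x‖ ^ 2 + (1 + α x) * u x ^ 2)

/-- `V_ε = {u ∈ H^1_0(Ω_ε) : |u|_{L^p} = 1}`. -/
def constraintSet {N : ℕ} (Ω : Set (EuclideanSpace ℝ (Fin N))) (p ε : ℝ) :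
    Set (EuclideanSpace ℝ (Fin N) → ℝ) :=
  {u | MemH10 (rescale Ω ε) u ∧ eLpNorm u (ENNReal.ofReal p) volume = 1}

/-- `m_ε`, the infimum of `E` over `V_ε`. -/
noncomputable def mEps {N : ℕ} (Ω : Set (EuclideanSpace ℝ (Fin N)))
    (α : EuclideanSpace ℝ (Fin N) → ℝ) (p ε : ℝ) : ℝ≥0∞ :=
  sInf (energy α '' constraintSet Ω p ε)

/-- `m`, the infimum of `∫ (|∇u|² + u²)` over the `u ∈ H^1(ℝ^N)` with `|u|_{L^p} = 1`. -/
noncomputable def mWhole (N : ℕ) (p : ℝ) : ℝ≥0∞ :=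
  sInf ((fun u : EuclideanSpace ℝ (Fin N) → ℝ =>
      ∫⁻ x, ENNReal.ofReal (‖weakGradient u x‖ ^ 2 + u x ^ 2)) ''
    {u | MemH1 u ∧ eLpNorm u (ENNReal.ofReal p) volume = 1})

end Concentrating

open scoped RealInnerProductSpace

namespace Concentrating

/-! The bound m ≤ m_ε is immediate from α ≥ 0, since every competitor for m_ε is one for m
(`mWhole_le_mEps`). For the converse, an unbounded domain that enlarges at infinity contains, after
rescaling, balls of any prescribed radius arbitrarily far from the origin (`exists_far_ball`). A
test function normalized in L^p can therefore be translated into Ω_ε and out to infinity. Its H^1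
norm and L^p norm do not change, while the potential term is at most sup φ² times the integral of α
far out, which tends to 0 because α is integrable. Density of test functions in H^1 ∩ L^p
(`HasWeakGradient.exists_tendsto_test`) then gives m_ε ≤ m (`mEps_le_mWhole`).

If u attained m_ε = m, then ∫(|∇u|² + u²) would already equal m, so that u minimizes on the whole
space and ∫ α u² = 0. It remains to see that a whole-space minimizer is nonzero almost everywhere,
for then α = 0 a.e., a contradiction. Now v = |u| is again a minimizer, and adding a nonnegative
multiple of a nonnegative test function cannot decrease the L^p norm of v; hence -Δv + v ≥ 0 weakly
(`isWeakSupersolution_of_minimizer`). No Euler–Lagrange equation or regularity theory is required.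

The strong maximum principle (`IsWeakSupersolution.ae_eq_zero`) comes from a mean value inequality.
Testing a smooth nonnegative supersolution w with rescaled radial bumps shows that its weighted
average A(r) around x satisfies A' ≤ (r/2)A, so A(r) is at most exp(r²/4) times a fixed multiple of
w(x). Applied to mollifications of v at a zero of v, with Fatou's lemma in the limit, this makes v
vanish on every ball. -/

/-- Euclidean space of dimension `N`. -/
abbrev Euc (N : ℕ) := EuclideanSpace ℝ (Fin N)

variable {N : ℕ}

/-! ### Test functions, weak gradients and the H^1 norm. -/

theorem continuous_gradient {u : Euc N → ℝ} (hu : ContDiff ℝ ∞ u) : Continuous (gradient u) :=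
  (InnerProductSpace.toDual ℝ (Euc N)).symm.continuous.comp (hu.continuous_fderiv (by simp))

theorem hasCompactSupport_gradient {u : Euc N → ℝ} (hu : HasCompactSupport u) :
    HasCompactSupport (gradient u) :=
  (hu.fderiv (𝕜 := ℝ)).comp_left (g := (InnerProductSpace.toDual ℝ (Euc N)).symm) (map_zero _)

namespace IsTestFunction

theorem continuous {D : Set (Euc N)} {φ : Euc N → ℝ} (h : IsTestFunction D φ) : Continuous φ :=
  h.1.continuous

theorem continuous_gradient {D : Set (Euc N)} {φ : Euc N → ℝ} (h : IsTestFunction D φ) :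
    Continuous (gradient φ) :=
  Concentrating.continuous_gradient h.1

theorem memLp {D : Set (Euc N)} {φ : Euc N → ℝ} (h : IsTestFunction D φ) (q : ℝ≥0∞) :
    MemLp φ q volume :=
  h.continuous.memLp_of_hasCompactSupport h.2.1

theorem memLp_gradient {D : Set (Euc N)} {φ : Euc N → ℝ} (h : IsTestFunction D φ) (q : ℝ≥0∞) :
    MemLp (gradient φ) q volume :=
  h.continuous_gradient.memLp_of_hasCompactSupport (hasCompactSupport_gradient h.2.1)

theorem comp_sub_right {D D' : Set (Euc N)} {φ : Euc N → ℝ} (h : IsTestFunction D φ) (y : Euc N)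
    (hD : ∀ x ∈ D, x + y ∈ D') : IsTestFunction D' (fun x => φ (x - y)) := by
  refine ⟨h.1.comp (contDiff_id.sub contDiff_const), ?_, ?_⟩
  · exact h.2.1.comp_homeomorph (Homeomorph.subRight y)
  · intro x hx
    have : x - y ∈ tsupport φ :=
      tsupport_comp_subset_preimage φ (f := fun x => x - y) (by fun_prop) hx
    simpa using hD _ (h.2.2 this)

theorem const_mul {D : Set (Euc N)} {φ : Euc N → ℝ} (h : IsTestFunction D φ) (c : ℝ) :
    IsTestFunction D (fun x => c * φ x) :=
  ⟨contDiff_const.mul h.1, h.2.1.mul_left,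
    (tsupport_mul_subset_right (f := fun _ => c) (g := φ)).trans h.2.2⟩

end IsTestFunction

theorem gradient_comp_sub_right (φ : Euc N → ℝ) (y x : Euc N) :
    gradient (fun x => φ (x - y)) x = gradient φ (x - y) := by
  simp only [gradient, fderiv_comp_sub]

theorem inner_integral_right {f : Euc N → Euc N} (hf : Integrable f) (v : Euc N) :
    ⟪v, ∫ x, f x⟫ = ∫ x, ⟪v, f x⟫ :=
  ((innerSL ℝ v).integral_comp_comm hf).symm

/-- A product of a locally integrable function with a continuous compactly supported one. -/
theorem integrable_smul_of_test {F : Type*} [NormedAddCommGroup F] [NormedSpace ℝ F]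
    {φ : Euc N → ℝ} {G : Euc N → F} (hφ : Continuous φ) (hc : HasCompactSupport φ)
    (hG : LocallyIntegrable G) : Integrable (fun x => φ x • G x) :=
  hG.integrable_smul_left_of_hasCompactSupport hφ hc

theorem integrable_smul_of_test' {F : Type*} [NormedAddCommGroup F] [NormedSpace ℝ F]
    {φ : Euc N → ℝ} {G : Euc N → F} (hG : Continuous G) (hc : HasCompactSupport G)
    (hφ : LocallyIntegrable φ) : Integrable (fun x => φ x • G x) :=
  hφ.integrable_smul_right_of_hasCompactSupport hG hc

/-- The weak gradient tested in a fixed direction. -/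
theorem HasWeakGradient.integral_inner {u : Euc N → ℝ} {G : Euc N → Euc N}
    (h : HasWeakGradient u G) {φ : Euc N → ℝ} (hφ : IsTestFunction univ φ) (v : Euc N) :
    ∫ x, u x * ⟪v, gradient φ x⟫ = - ∫ x, φ x * ⟪v, G x⟫ := by
  have := congrArg (fun w => ⟪v, w⟫) (h.2.2 φ hφ)
  rw [inner_neg_right, inner_integral_right, inner_integral_right] at this
  · simpa only [real_inner_smul_right] using this
  · exact integrable_smul_of_test hφ.continuous hφ.2.1 h.2.1
  · exact integrable_smul_of_test' hφ.continuous_gradient (hasCompactSupport_gradient hφ.2.1) h.1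

theorem hasWeakGradient_gradient {u : Euc N → ℝ} (hu : ContDiff ℝ ∞ u) :
    HasWeakGradient u (gradient u) := by
  have hc := continuous_gradient hu
  refine ⟨hu.continuous.locallyIntegrable, hc.locallyIntegrable, fun φ hφ => ?_⟩
  have i1 : Integrable (fun x => u x • gradient φ x) :=
    integrable_smul_of_test' hφ.continuous_gradient (hasCompactSupport_gradient hφ.2.1)
      hu.continuous.locallyIntegrable
  have i2 : Integrable (fun x => φ x • gradient u x) :=
    integrable_smul_of_test hφ.continuous hφ.2.1 hc.locallyIntegrable
  refine ext_inner_left ℝ fun v => ?_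
  rw [inner_neg_right, inner_integral_right i1, inner_integral_right i2]
  have key := integral_mul_fderiv_eq_neg_fderiv_mul_of_integrable (μ := volume) (f := u) (g := φ)
    (v := v) ?_ ?_ ?_ (fun x _ => hu.differentiable (by simp) x)
    (fun x _ => hφ.1.differentiable (by simp) x)
  · simp only [real_inner_smul_right, inner_gradient_right, conj_trivial]
    rw [key]
    simp only [mul_comm]
  · have := (innerSL ℝ v).integrable_comp i2
    refine this.congr (ae_of_all _ fun x => ?_)
    simp [inner_gradient_right, mul_comm]
  · have := (innerSL ℝ v).integrable_comp i1
    refine this.congr (ae_of_all _ fun x => ?_)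
    simp [inner_gradient_right]
  · exact integrable_smul_of_test' hφ.continuous hφ.2.1 hu.continuous.locallyIntegrable

theorem HasWeakGradient.ae_eq {u : Euc N → ℝ} {G G' : Euc N → Euc N}
    (h : HasWeakGradient u G) (h' : HasWeakGradient u G') : G =ᵐ[volume] G' :=
  ae_eq_of_integral_contDiff_smul_eq h.2.1 h'.2.1 fun φ h1 h2 => by
    have := (h.2.2 φ ⟨h1, h2, subset_univ _⟩).symm.trans (h'.2.2 φ ⟨h1, h2, subset_univ _⟩)
    exact neg_injective this

theorem HasWeakGradient.hasWeakGradient_weakGradient {u : Euc N → ℝ} {G : Euc N → Euc N}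
    (h : HasWeakGradient u G) : HasWeakGradient u (weakGradient u) := by
  have hex : ∃ G, HasWeakGradient u G := ⟨G, h⟩
  rw [weakGradient, dif_pos hex]
  exact hex.choose_spec

theorem HasWeakGradient.weakGradient_ae_eq {u : Euc N → ℝ} {G : Euc N → Euc N}
    (h : HasWeakGradient u G) : weakGradient u =ᵐ[volume] G :=
  h.hasWeakGradient_weakGradient.ae_eq h

theorem HasWeakGradient.add {u v : Euc N → ℝ} {G H : Euc N → Euc N}
    (hu : HasWeakGradient u G) (hv : HasWeakGradient v H) :
    HasWeakGradient (fun x => u x + v x) (fun x => G x + H x) := by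
  refine ⟨hu.1.add hv.1, hu.2.1.add hv.2.1, fun φ hφ => ?_⟩
  have hφc := hasCompactSupport_gradient hφ.2.1
  simp only [add_smul, smul_add]
  rw [integral_add (integrable_smul_of_test' hφ.continuous_gradient hφc hu.1)
      (integrable_smul_of_test' hφ.continuous_gradient hφc hv.1),
    integral_add (integrable_smul_of_test hφ.continuous hφ.2.1 hu.2.1)
      (integrable_smul_of_test hφ.continuous hφ.2.1 hv.2.1), hu.2.2 φ hφ, hv.2.2 φ hφ, neg_add]

theorem HasWeakGradient.const_mul {u : Euc N → ℝ} {G : Euc N → Euc N}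
    (hu : HasWeakGradient u G) (c : ℝ) :
    HasWeakGradient (fun x => c * u x) (fun x => c • G x) := by
  refine ⟨hu.1.smul c, hu.2.1.smul c, fun φ hφ => ?_⟩
  simp only [mul_smul, smul_comm _ c]
  rw [integral_smul, integral_smul, hu.2.2 φ hφ, smul_neg]

theorem MemH1.hasWeakGradient {u : Euc N → ℝ} (h : MemH1 u) :
    HasWeakGradient u (weakGradient u) := by
  obtain ⟨_, G, hG, _⟩ := h
  exact hG.hasWeakGradient_weakGradient

theorem MemH1.memLp_weakGradient {u : Euc N → ℝ} (h : MemH1 u) : MemLp (weakGradient u) 2 := by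
  obtain ⟨_, G, hG, hG2⟩ := h
  exact hG2.ae_eq hG.weakGradient_ae_eq.symm

theorem IsTestFunction.weakGradient_ae_eq {D : Set (Euc N)} {φ : Euc N → ℝ}
    (h : IsTestFunction D φ) : weakGradient φ =ᵐ[volume] gradient φ :=
  (hasWeakGradient_gradient h.1).weakGradient_ae_eq

theorem IsTestFunction.memH1 {D : Set (Euc N)} {φ : Euc N → ℝ} (h : IsTestFunction D φ) :
    MemH1 φ :=
  ⟨h.memLp 2, gradient φ, hasWeakGradient_gradient h.1, h.memLp_gradient 2⟩

theorem IsTestFunction.memH10 {D : Set (Euc N)} {φ : Euc N → ℝ} (h : IsTestFunction D φ) :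
    MemH10 D φ := by
  refine ⟨h.memH1, fun δ hδ => ⟨φ, h, by simpa using hδ, ?_⟩⟩
  have : (fun x => weakGradient φ x - gradient φ x) =ᵐ[volume] fun _ => (0 : Euc N) := by
    filter_upwards [h.weakGradient_ae_eq] with x hx
    simp [hx]
  rw [eLpNorm_congr_ae this]
  simpa using hδ

/-- The squared `H^1` norm. -/
noncomputable def sobolevSq (u : Euc N → ℝ) : ℝ≥0∞ :=
  ∫⁻ x, ENNReal.ofReal (‖weakGradient u x‖ ^ 2 + u x ^ 2)

theorem lintegral_ofReal_norm_sq {F : Type*} [NormedAddCommGroup F] (f : Euc N → F) :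
    ∫⁻ x, ENNReal.ofReal (‖f x‖ ^ 2) = eLpNorm f 2 volume ^ 2 := by
  rw [eLpNorm_eq_lintegral_rpow_enorm_toReal (by simp) (by simp)]
  simp only [ENNReal.toReal_ofNat, ENNReal.rpow_ofNat, one_div]
  rw [← ENNReal.rpow_natCast, ← ENNReal.rpow_mul]
  simp [ENNReal.ofReal_pow]

theorem HasWeakGradient.sobolevSq_eq {u : Euc N → ℝ} {G : Euc N → Euc N}
    (h : HasWeakGradient u G) :
    sobolevSq u = eLpNorm G 2 volume ^ 2 + eLpNorm u 2 volume ^ 2 := by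
  rw [← lintegral_ofReal_norm_sq, ← lintegral_ofReal_norm_sq, ← lintegral_add_right']
  · refine lintegral_congr_ae ?_
    filter_upwards [h.weakGradient_ae_eq] with x hx
    rw [hx, ENNReal.ofReal_add (by positivity) (by positivity), Real.norm_eq_abs, sq_abs]
  · exact (h.1.aestronglyMeasurable.norm.aemeasurable.pow_const 2).ennreal_ofReal

theorem mWhole_eq (p : ℝ) : mWhole N p =
    sInf (sobolevSq '' {u : Euc N → ℝ | MemH1 u ∧ eLpNorm u (ENNReal.ofReal p) volume = 1}) := rfl

/-! ### Mollification in L^q and of weak gradients. -/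

/-- A shrinking sequence of smooth bump functions. -/
noncomputable def shrinkingBump (N : ℕ) (n : ℕ) : ContDiffBump (0 : Euc N) where
  rIn := ((n : ℝ) + 1)⁻¹
  rOut := 2 * ((n : ℝ) + 1)⁻¹
  rIn_pos := by positivity
  rIn_lt_rOut := by
    have : (0 : ℝ) < ((n : ℝ) + 1)⁻¹ := by positivity
    linarith

/-- The standard mollifiers. -/
noncomputable def mollifier (N : ℕ) (n : ℕ) : Euc N → ℝ :=
  (shrinkingBump N n).normed volume

/-- The convolution of `f` with a mollifier. -/
noncomputable def mollify {F : Type*} [NormedAddCommGroup F] [NormedSpace ℝ F] (n : ℕ)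
    (f : Euc N → F) (x : Euc N) : F :=
  ∫ t, mollifier N n t • f (x - t)

theorem mollify_eq_convolution {F : Type*} [NormedAddCommGroup F] [NormedSpace ℝ F] (n : ℕ)
    (f : Euc N → F) :
    mollify n f = convolution (mollifier N n) f (ContinuousLinearMap.lsmul ℝ ℝ) volume := rfl

theorem tendsto_rOut_shrinkingBump :
    Tendsto (fun n => (shrinkingBump N n).rOut) atTop (𝓝 0) := by
  have := (tendsto_one_div_add_atTop_nhds_zero_nat (𝕜 := ℝ)).const_mul 2
  simpa [shrinkingBump, one_div] using this

theorem contDiff_mollifier (n : ℕ) : ContDiff ℝ ∞ (mollifier N n) :=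
  (shrinkingBump N n).contDiff_normed (n := ⊤)

theorem hasCompactSupport_mollifier (n : ℕ) : HasCompactSupport (mollifier N n) :=
  (shrinkingBump N n).hasCompactSupport_normed

theorem mollifier_nonneg (n : ℕ) (x : Euc N) : 0 ≤ mollifier N n x :=
  (shrinkingBump N n).nonneg_normed x

theorem integral_mollifier (n : ℕ) : ∫ x, mollifier N n x = 1 :=
  (shrinkingBump N n).integral_normed

theorem integrable_mollifier (n : ℕ) : Integrable (mollifier N n) :=
  (shrinkingBump N n).integrable_normed

theorem integrable_mollify_integrand {F : Type*} [NormedAddCommGroup F] [NormedSpace ℝ F] (n : ℕ)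
    {f : Euc N → F} (hf : LocallyIntegrable f) (x : Euc N) :
    Integrable (fun t => mollifier N n t • f (x - t)) :=
  (hasCompactSupport_mollifier n).convolutionExists_left (ContinuousLinearMap.lsmul ℝ ℝ)
    (contDiff_mollifier n).continuous hf x

theorem contDiff_mollify {F : Type*} [NormedAddCommGroup F] [NormedSpace ℝ F] (n : ℕ)
    {f : Euc N → F} (hf : LocallyIntegrable f) : ContDiff ℝ ∞ (mollify n f) := by
  rw [mollify_eq_convolution]
  exact (hasCompactSupport_mollifier n).contDiff_convolution_left (n := ⊤) _ (contDiff_mollifier n) hf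

theorem ae_tendsto_mollify {F : Type*} [NormedAddCommGroup F] [NormedSpace ℝ F] [CompleteSpace F]
    {f : Euc N → F} (hf : LocallyIntegrable f) :
    ∀ᵐ x, Tendsto (fun n => mollify n f x) atTop (𝓝 (f x)) :=
  ContDiffBump.ae_convolution_tendsto_right_of_locallyIntegrable (K := 2)
    tendsto_rOut_shrinkingBump (Eventually.of_forall fun n => le_of_eq (by simp [shrinkingBump])) hf

/-- Translations are continuous in `L^q`. -/
theorem tendsto_eLpNorm_translate_sub {F : Type*} [NormedAddCommGroup F]
    {f : Euc N → F} {q : ℝ≥0∞} (hq : 1 ≤ q) (hq' : q ≠ ⊤) (hf : MemLp f q volume) :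
    Tendsto (fun h : Euc N => eLpNorm (fun x => f (x - h) - f x) q volume) (𝓝 0) (𝓝 0) := by
  have : Fact (1 ≤ q) := ⟨hq⟩
  -- Translations form a continuous family in the compact-open topology, which is the form in which
  -- composition on L^q depends continuously on the map.
  let g : Euc N → C(Euc N, Euc N) :=
    fun h => ContinuousMap.curry ⟨fun p : Euc N × Euc N => p.2 - p.1, by fun_prop⟩ h
  have hg : Continuous g := (ContinuousMap.curry _).continuous
  have hgm : ∀ h, MeasurePreserving (g h) volume volume := fun h =>
    measurePreserving_sub_right volume h
  have hlim : Tendsto (fun h => Lp.compMeasurePreserving (g h) (hgm h) (hf.toLp f)) (𝓝 0)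
      (𝓝 (Lp.compMeasurePreserving (g 0) (hgm 0) (hf.toLp f))) :=
    Filter.Tendsto.compMeasurePreservingLp tendsto_const_nhds (hg.tendsto 0) hgm (hgm 0) hq'
  rw [tendsto_iff_edist_tendsto_0] at hlim
  refine hlim.congr fun h => ?_
  rw [Lp.toLp_compMeasurePreserving, Lp.toLp_compMeasurePreserving, Lp.edist_toLp_toLp]
  congr 1
  ext x
  simp [g]

/-- Jensen's inequality: the mollification is an average against the probability measure whose
density is the mollifier, so the q-th power of an average is at most the average of q-th powers. -/
theorem enorm_mollify_sub_rpow_le {F : Type*} [NormedAddCommGroup F] [NormedSpace ℝ F]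
    [CompleteSpace F] (n : ℕ)
    {f : Euc N → F} (hf : LocallyIntegrable f) {q : ℝ} (hq : 1 ≤ q) (x : Euc N) :
    ‖mollify n f x - f x‖ₑ ^ q ≤
      ∫⁻ t, ENNReal.ofReal (mollifier N n t) * ‖f (x - t) - f x‖ₑ ^ q := by
  set ν : Measure (Euc N) := volume.withDensity fun t => ENNReal.ofReal (mollifier N n t) with hν
  have hm : Measurable fun t => ENNReal.ofReal (mollifier N n t) :=
    (contDiff_mollifier n).continuous.measurable.ennreal_ofReal
  have hprob : IsProbabilityMeasure ν := by
    constructor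
    rw [hν, withDensity_apply _ MeasurableSet.univ, Measure.restrict_univ,
      ← ofReal_integral_eq_lintegral_ofReal (integrable_mollifier n)
        (ae_of_all _ (mollifier_nonneg n)), integral_mollifier, ENNReal.ofReal_one]
  have hfm : AEStronglyMeasurable (fun t => f (x - t) - f x) volume :=
    (hf.aestronglyMeasurable.comp_quasiMeasurePreserving
      (quasiMeasurePreserving_sub_left volume x)).sub aestronglyMeasurable_const
  have h1 : mollify n f x - f x = ∫ t, mollifier N n t • (f (x - t) - f x) := by
    simp only [smul_sub]
    rw [integral_sub (integrable_mollify_integrand n hf x)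
      ((integrable_mollifier n).smul_const _), integral_smul_const, integral_mollifier, one_smul]
    rfl
  have h2 : ‖mollify n f x - f x‖ₑ ≤ ∫⁻ t, ‖f (x - t) - f x‖ₑ ∂ν := by
    rw [h1, hν, lintegral_withDensity_eq_lintegral_mul₀ hm.aemeasurable hfm.enorm]
    refine (enorm_integral_le_lintegral_enorm _).trans (le_of_eq (lintegral_congr fun t => ?_))
    rw [enorm_smul, Real.enorm_eq_ofReal (mollifier_nonneg n t)]
    rfl
  have h3 := eLpNorm_le_eLpNorm_of_exponent_le (p := 1) (q := ENNReal.ofReal q) (μ := ν)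
    (by simpa using hq) (hfm.mono_ac (withDensity_absolutelyContinuous _ _))
  rw [eLpNorm_one_eq_lintegral_enorm, eLpNorm_eq_lintegral_rpow_enorm_toReal
    (by simpa using by linarith) (by simp), ENNReal.toReal_ofReal (by linarith)] at h3
  have h4 := ENNReal.rpow_le_rpow (h2.trans h3) (by linarith : 0 ≤ q)
  rw [← ENNReal.rpow_mul, one_div, inv_mul_cancel₀ (by linarith), ENNReal.rpow_one, hν,
    lintegral_withDensity_eq_lintegral_mul₀ hm.aemeasurable (hfm.enorm.pow_const _)] at h4
  exact h4

/-- Integrating the Jensen bound in x and exchanging integrals, only translations by vectors in the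
support of the mollifier contribute. -/
theorem eLpNorm_mollify_sub_le {F : Type*} [NormedAddCommGroup F] [NormedSpace ℝ F]
    [CompleteSpace F] (n : ℕ)
    {f : Euc N → F} {q : ℝ} (hq : 1 ≤ q) (hf : MemLp f (ENNReal.ofReal q) volume)
    {δ : ℝ≥0∞} (hδ : ∀ t, ‖t‖ < (shrinkingBump N n).rOut →
      eLpNorm (fun x => f (x - t) - f x) (ENNReal.ofReal q) volume ≤ δ) :
    eLpNorm (fun x => mollify n f x - f x) (ENNReal.ofReal q) volume ≤ δ := by
  have hq0 : 0 < q := by linarith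
  have hloc : LocallyIntegrable f := hf.locallyIntegrable (by simpa using hq)
  have hm : Measurable fun t => ENNReal.ofReal (mollifier N n t) :=
    (contDiff_mollifier n).continuous.measurable.ennreal_ofReal
  have e : ∀ g : Euc N → F, eLpNorm g (ENNReal.ofReal q) volume ^ q = ∫⁻ x, ‖g x‖ₑ ^ q := by
    intro g
    rw [eLpNorm_eq_lintegral_rpow_enorm_toReal (by simpa using hq0) (by simp),
      ENNReal.toReal_ofReal hq0.le, ← ENNReal.rpow_mul, one_div, inv_mul_cancel₀ hq0.ne',
      ENNReal.rpow_one]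
  rw [← ENNReal.rpow_le_rpow_iff hq0, e]
  calc ∫⁻ x, ‖mollify n f x - f x‖ₑ ^ q
      ≤ ∫⁻ x, ∫⁻ t, ENNReal.ofReal (mollifier N n t) * ‖f (x - t) - f x‖ₑ ^ q :=
        lintegral_mono fun x => enorm_mollify_sub_rpow_le n hloc hq x
    _ = ∫⁻ t, ∫⁻ x, ENNReal.ofReal (mollifier N n t) * ‖f (x - t) - f x‖ₑ ^ q := by
        refine lintegral_lintegral_swap ?_
        refine (hm.comp measurable_snd).aemeasurable.mul (AEMeasurable.pow_const ?_ _)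
        refine (AEStronglyMeasurable.sub ?_ hf.1.comp_fst).enorm
        exact hf.1.comp_quasiMeasurePreserving (quasiMeasurePreserving_sub volume volume)
    _ = ∫⁻ t, ENNReal.ofReal (mollifier N n t) * ∫⁻ x, ‖f (x - t) - f x‖ₑ ^ q := by
        simp only [lintegral_const_mul' _ _ ENNReal.ofReal_ne_top]
    _ ≤ ∫⁻ t, ENNReal.ofReal (mollifier N n t) * δ ^ q := by
        refine lintegral_mono fun t => ?_
        by_cases ht : ‖t‖ < (shrinkingBump N n).rOut
        · gcongr
          rw [← e]
          exact ENNReal.rpow_le_rpow (hδ t ht) hq0.le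
        · have : mollifier N n t = 0 := by
            rw [← Function.notMem_support, mollifier, ContDiffBump.support_normed_eq]
            simpa using ht
          simp [this]
    _ = δ ^ q := by
        rw [lintegral_mul_const _ hm, ← ofReal_integral_eq_lintegral_ofReal
          (integrable_mollifier n) (ae_of_all _ (mollifier_nonneg n)), integral_mollifier,
          ENNReal.ofReal_one, one_mul]

theorem tendsto_eLpNorm_mollify_sub {F : Type*} [NormedAddCommGroup F] [NormedSpace ℝ F]
    [CompleteSpace F]
    {f : Euc N → F} {q : ℝ} (hq : 1 ≤ q) (hf : MemLp f (ENNReal.ofReal q) volume) :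
    Tendsto (fun n => eLpNorm (fun x => mollify n f x - f x) (ENNReal.ofReal q) volume)
      atTop (𝓝 0) := by
  rw [ENNReal.tendsto_nhds_zero]
  intro δ hδ
  have h := tendsto_eLpNorm_translate_sub (by simpa using hq) (by simp) hf
  rw [ENNReal.tendsto_nhds_zero] at h
  obtain ⟨r, hr, hball⟩ := Metric.eventually_nhds_iff.1 (h δ hδ)
  filter_upwards [tendsto_rOut_shrinkingBump.eventually (gt_mem_nhds hr)] with n hn
  exact eLpNorm_mollify_sub_le n hq hf fun t ht => hball (by simpa using ht.trans hn)

theorem mollify_nonneg (n : ℕ) {f : Euc N → ℝ} (hf : ∀ x, 0 ≤ f x) (x : Euc N) :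
    0 ≤ mollify n f x :=
  integral_nonneg fun t => mul_nonneg (mollifier_nonneg n t) (hf _)

theorem mollify_swap {F : Type*} [NormedAddCommGroup F] [NormedSpace ℝ F] (n : ℕ)
    (f : Euc N → F) (x : Euc N) :
    mollify n f x = ∫ t, mollifier N n (x - t) • f t := by
  rw [mollify_eq_convolution, convolution_lsmul_swap]

theorem fderiv_mollify_apply (n : ℕ) {f : Euc N → ℝ} (hf : LocallyIntegrable f) (x v : Euc N) :
    fderiv ℝ (mollify n f) x v = ∫ t, fderiv ℝ (mollifier N n) (x - t) v * f t := by
  have h := (hasCompactSupport_mollifier (N := N) n).hasFDerivAt_convolution_left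
    (ContinuousLinearMap.lsmul ℝ ℝ) ((contDiff_mollifier n).of_le (by simp)) hf x
  rw [mollify_eq_convolution, h.fderiv, convolution_eq_swap, ContinuousLinearMap.integral_apply]
  · rfl
  · have h2 := ((hasCompactSupport_mollifier (N := N) n).fderiv ℝ).convolutionExists_left
      ((ContinuousLinearMap.lsmul ℝ ℝ).precompL (Euc N))
      ((contDiff_mollifier n).continuous_fderiv (by simp)) hf x
    exact h2.integrable_swap

/-- Mollification commutes with the weak gradient. -/
theorem HasWeakGradient.gradient_mollify {u : Euc N → ℝ} {G : Euc N → Euc N}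
    (h : HasWeakGradient u G) (n : ℕ) : gradient (mollify n u) = mollify n G := by
  funext x
  refine ext_inner_left ℝ fun v => ?_
  rw [inner_gradient_right, conj_trivial, fderiv_mollify_apply n h.1, mollify_swap]
  -- The reflected mollifier is the test function; the sign produced by the reflection cancels the
  -- one in the definition of the weak gradient.
  have hφ : IsTestFunction univ (fun t => mollifier N n (x - t)) := by
    refine ⟨(contDiff_mollifier n).comp (contDiff_const.sub contDiff_id), ?_, subset_univ _⟩
    exact (hasCompactSupport_mollifier n).comp_homeomorph (Homeomorph.subLeft x)
  have hw := h.integral_inner hφ v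
  rw [inner_integral_right (integrable_smul_of_test hφ.continuous hφ.2.1 h.2.1)]
  simp only [real_inner_smul_right]
  rw [← neg_eq_iff_eq_neg] at hw
  rw [← hw, ← integral_neg]
  refine integral_congr_ae (ae_of_all _ fun t => ?_)
  have hd : HasFDerivAt (fun t => mollifier N n (x - t))
      (-(fderiv ℝ (mollifier N n) (x - t))) t := by
    have h1 := (((contDiff_mollifier n).differentiable (by simp)) (x - t)).hasFDerivAt (𝕜 := ℝ)
    simpa [Function.comp_def] using! h1.comp t ((hasFDerivAt_const x t).sub (hasFDerivAt_id t))
  simp only [inner_gradient_right, conj_trivial, hd.fderiv, neg_apply]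
  ring

/-! ### Cutoff functions and density of test functions in H^1 ∩ L^p. -/

theorem tendsto_eLpNorm_zero_of_dominated {F : Type*} [NormedAddCommGroup F] {q : ℝ} (hq : 0 < q)
    {f : ℕ → Euc N → F} {g : Euc N → ℝ} (hf : ∀ n, AEStronglyMeasurable (f n) volume)
    (hg : MemLp g (ENNReal.ofReal q) volume) (hfg : ∀ n, ∀ᵐ x, ‖f n x‖ ≤ g x)
    (hlim : ∀ᵐ x, Tendsto (fun n => f n x) atTop (𝓝 0)) :
    Tendsto (fun n => eLpNorm (f n) (ENNReal.ofReal q) volume) atTop (𝓝 0) := by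
  have hq0 : ENNReal.ofReal q ≠ 0 := by simpa using hq
  simp only [eLpNorm_eq_lintegral_rpow_enorm_toReal hq0 ENNReal.ofReal_ne_top,
    ENNReal.toReal_ofReal hq.le]
  have hfin : ∫⁻ x, ‖g x‖ₑ ^ q ≠ ⊤ := by
    have := (lintegral_rpow_enorm_lt_top_of_eLpNorm_lt_top hq0 ENNReal.ofReal_ne_top hg.2).ne
    rwa [ENNReal.toReal_ofReal hq.le] at this
  have h := tendsto_lintegral_of_dominated_convergence' (μ := (volume : Measure (Euc N)))
    (F := fun n x => ‖f n x‖ₑ ^ q) (f := fun _ => 0) (fun x => ‖g x‖ₑ ^ q)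
    (fun n => (hf n).enorm.pow_const _) (fun n => ?_) hfin ?_
  · have h2 := h.ennrpow_const (1 / q)
    simpa [hq] using h2
  · filter_upwards [hfg n] with x hx
    refine ENNReal.rpow_le_rpow ?_ hq.le
    rw [← ofReal_norm, ← ofReal_norm]
    exact ENNReal.ofReal_le_ofReal (hx.trans (le_abs_self _))
  · filter_upwards [hlim] with x hx
    have := (hx.enorm).ennrpow_const q
    simpa [hq] using this

/-- The fixed profile of the cutoff functions. -/
noncomputable def cutoffProfile (N : ℕ) : ContDiffBump (0 : Euc N) where
  rIn := 1
  rOut := 2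
  rIn_pos := one_pos
  rIn_lt_rOut := one_lt_two

/-- A smooth cutoff function, equal to `1` on the ball of radius `m + 1`. -/
noncomputable def cutoff (N : ℕ) (m : ℕ) (x : Euc N) : ℝ :=
  cutoffProfile N (((m : ℝ) + 1)⁻¹ • x)

theorem contDiff_cutoff (m : ℕ) : ContDiff ℝ ∞ (cutoff N m) :=
  ((cutoffProfile N).contDiff (n := ⊤)).comp (contDiff_const_smul _)

theorem hasCompactSupport_cutoff (m : ℕ) : HasCompactSupport (cutoff N m) := by
  have hm : ((m : ℝ) + 1)⁻¹ ≠ 0 := by positivity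
  exact (cutoffProfile N).hasCompactSupport.comp_homeomorph (Homeomorph.smulOfNeZero _ hm)

theorem cutoff_nonneg (m : ℕ) (x : Euc N) : 0 ≤ cutoff N m x := (cutoffProfile N).nonneg

theorem cutoff_le_one (m : ℕ) (x : Euc N) : cutoff N m x ≤ 1 := (cutoffProfile N).le_one

theorem cutoff_eq_one {m : ℕ} {x : Euc N} (hx : ‖x‖ ≤ m + 1) : cutoff N m x = 1 := by
  refine (cutoffProfile N).one_of_mem_closedBall ?_
  have hm : (0 : ℝ) < (m : ℝ) + 1 := by positivity
  rw [mem_closedBall_zero_iff, norm_smul, norm_inv, Real.norm_of_nonneg hm.le, inv_mul_le_iff₀ hm]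
  simpa [cutoffProfile] using hx

theorem tendsto_cutoff (x : Euc N) : ∀ᶠ m : ℕ in atTop, cutoff N m x = 1 := by
  obtain ⟨k, hk⟩ := exists_nat_ge ‖x‖
  filter_upwards [eventually_ge_atTop k] with m hm
  have : (k : ℝ) ≤ m := by exact_mod_cast hm
  exact cutoff_eq_one (by linarith)

theorem exists_norm_gradient_cutoff_le :
    ∃ C : ℝ, 0 ≤ C ∧ ∀ m (x : Euc N), ‖gradient (cutoff N m) x‖ ≤ C * ((m : ℝ) + 1)⁻¹ := by
  have hd : ContDiff ℝ ∞ (cutoffProfile N) := (cutoffProfile N).contDiff (n := ⊤)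
  obtain ⟨C, hC⟩ := ((cutoffProfile N).hasCompactSupport.fderiv ℝ).exists_bound_of_continuous
    (hd.continuous_fderiv (by simp))
  refine ⟨C, (norm_nonneg _).trans (hC 0), fun m x => ?_⟩
  have h : fderiv ℝ (cutoff N m) x =
      ((m : ℝ) + 1)⁻¹ • fderiv ℝ (cutoffProfile N) (((m : ℝ) + 1)⁻¹ • x) :=
    fderiv_comp_smul (f := cutoffProfile N) _
  rw [gradient, LinearIsometryEquiv.norm_map, h, norm_smul, norm_inv,
    Real.norm_of_nonneg (by positivity), mul_comm]
  gcongr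
  exact hC _

theorem tendsto_eLpNorm_cutoff_smul_sub {F : Type*} [NormedAddCommGroup F] [NormedSpace ℝ F]
    {f : Euc N → F} {q : ℝ} (hq : 0 < q) (hf : MemLp f (ENNReal.ofReal q) volume) :
    Tendsto (fun m => eLpNorm (fun x => cutoff N m x • f x - f x) (ENNReal.ofReal q) volume)
      atTop (𝓝 0) := by
  refine tendsto_eLpNorm_zero_of_dominated hq
    (fun m => ((contDiff_cutoff m).continuous.aestronglyMeasurable.smul hf.1).sub hf.1) hf.norm
    (fun m => ae_of_all _ fun x => ?_) (ae_of_all _ fun x => ?_)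
  · have : cutoff N m x • f x - f x = (cutoff N m x - 1) • f x := by rw [sub_smul, one_smul]
    rw [this, norm_smul, Real.norm_eq_abs]
    refine mul_le_of_le_one_left (norm_nonneg _) (abs_le.2 ⟨?_, ?_⟩)
    · linarith [cutoff_nonneg m x]
    · linarith [cutoff_le_one m x]
  · refine tendsto_const_nhds.congr' ?_
    filter_upwards [tendsto_cutoff x] with m hm
    simp [hm]

theorem gradient_mul {f g : Euc N → ℝ} {x : Euc N} (hf : DifferentiableAt ℝ f x)
    (hg : DifferentiableAt ℝ g x) :
    gradient (fun x => f x * g x) x = f x • gradient g x + g x • gradient f x := by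
  simp only [gradient, fderiv_fun_mul hf hg, map_add, map_smul]

/-- The product rule leaves the extra term w∇χ_m, whose L^2 norm is O(1/m) because the cutoff is a
fixed profile stretched by m + 1. -/
theorem tendsto_eLpNorm_gradient_cutoff_mul_sub {w : Euc N → ℝ} (hw : ContDiff ℝ ∞ w)
    (hw2 : MemLp w 2 volume) (hG : MemLp (gradient w) 2 volume) :
    Tendsto (fun m => eLpNorm (fun x => gradient (fun y => cutoff N m y * w y) x - gradient w x)
      2 volume) atTop (𝓝 0) := by
  obtain ⟨C, hC0, hC⟩ := exists_norm_gradient_cutoff_le (N := N)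
  have e2 : ENNReal.ofReal 2 = 2 := by simp
  have h1 := tendsto_eLpNorm_cutoff_smul_sub (q := 2) two_pos (by rwa [e2])
  rw [e2] at h1
  have h2 : Tendsto (fun m : ℕ => ENNReal.ofReal (C * ((m : ℝ) + 1)⁻¹) * eLpNorm w 2 volume)
      atTop (𝓝 0) := by
    have : Tendsto (fun m : ℕ => C * ((m : ℝ) + 1)⁻¹) atTop (𝓝 0) := by
      simpa [one_div] using (tendsto_one_div_add_atTop_nhds_zero_nat (𝕜 := ℝ)).const_mul C
    have := ENNReal.tendsto_ofReal this
    rw [ENNReal.ofReal_zero] at this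
    simpa using ENNReal.Tendsto.mul_const this (Or.inr hw2.2.ne)
  have h3 := h1.add h2
  rw [add_zero] at h3
  refine tendsto_of_tendsto_of_tendsto_of_le_of_le tendsto_const_nhds h3 (fun _ => zero_le)
    fun m => ?_
  have hcg := continuous_gradient (contDiff_cutoff (N := N) m)
  have e : (fun x => gradient (fun y => cutoff N m y * w y) x - gradient w x) =
      (fun x => cutoff N m x • gradient w x - gradient w x) +
        fun x => w x • gradient (cutoff N m) x := by
    funext x
    rw [gradient_mul ((contDiff_cutoff m).differentiable (by simp) x)
      (hw.differentiable (by simp) x), Pi.add_apply]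
    abel
  simp only [e]
  refine (eLpNorm_add_le ?_ ?_ (by simp)).trans (add_le_add le_rfl ?_)
  · exact ((contDiff_cutoff m).continuous.aestronglyMeasurable.smul hG.1).sub hG.1
  · exact hw2.1.smul hcg.aestronglyMeasurable
  · refine eLpNorm_le_mul_eLpNorm_of_ae_le_mul (ae_of_all _ fun x => ?_) 2
    rw [norm_smul, mul_comm]
    gcongr
    exact hC m x

/-- Test functions are dense in `H^1 ∩ L^p`. -/
theorem HasWeakGradient.exists_tendsto_test {u : Euc N → ℝ} {G : Euc N → Euc N}
    (h : HasWeakGradient u G) (hu : MemLp u 2 volume) (hG : MemLp G 2 volume) {p : ℝ} (hp : 1 ≤ p)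
    (hup : MemLp u (ENNReal.ofReal p) volume) :
    ∃ φ : ℕ → Euc N → ℝ, (∀ n, IsTestFunction univ (φ n)) ∧
      Tendsto (fun n => eLpNorm (fun x => φ n x - u x) 2 volume) atTop (𝓝 0) ∧
      Tendsto (fun n => eLpNorm (fun x => φ n x - u x) (ENNReal.ofReal p) volume) atTop (𝓝 0) ∧
      Tendsto (fun n => eLpNorm (fun x => gradient (φ n) x - G x) 2 volume) atTop (𝓝 0) := by
  have e2 : ENNReal.ofReal 2 = 2 := by simp
  have hp0 : 0 < p := by linarith
  have hp1 : 1 ≤ ENNReal.ofReal p := by simpa using hp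
  have main : ∀ δ : ℝ≥0∞, 0 < δ → ∃ φ : Euc N → ℝ, IsTestFunction univ φ ∧
      eLpNorm (fun x => φ x - u x) 2 volume ≤ δ + δ ∧
      eLpNorm (fun x => φ x - u x) (ENNReal.ofReal p) volume ≤ δ + δ ∧
      eLpNorm (fun x => gradient φ x - G x) 2 volume ≤ δ + δ := by
    intro δ hδ
    -- Finiteness of δ is what puts the mollification into L^q below; for δ = ⊤ the bounds are
    -- vacuous and the function found for δ = 1 serves.
    wlog hδ' : δ ≠ ⊤
    · rw [not_not] at hδ'
      obtain ⟨φ, h0, _⟩ := this h hu hG hp hup e2 hp0 hp1 1 one_pos (by simp)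
      exact ⟨φ, h0, by simp [hδ']⟩
    have m1 := tendsto_eLpNorm_mollify_sub (f := u) (q := 2) one_le_two (by rwa [e2])
    have m2 := tendsto_eLpNorm_mollify_sub hp hup
    have m3 := tendsto_eLpNorm_mollify_sub (f := G) (q := 2) one_le_two (by rwa [e2])
    rw [e2] at m1 m3
    obtain ⟨n, n1, n2, n3⟩ := ((ENNReal.tendsto_nhds_zero.1 m1 δ hδ).and
      ((ENNReal.tendsto_nhds_zero.1 m2 δ hδ).and (ENNReal.tendsto_nhds_zero.1 m3 δ hδ))).exists
    set w := mollify n u with hw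
    have hws : ContDiff ℝ ∞ w := contDiff_mollify n h.1
    have hgw : gradient w = mollify n G := h.gradient_mollify n
    have hgws : Continuous (gradient w) := continuous_gradient hws
    have mem : ∀ {F : Type} [NormedAddCommGroup F] {a b : Euc N → F} {q : ℝ≥0∞},
        Continuous a → MemLp b q volume → eLpNorm (fun x => a x - b x) q volume ≤ δ →
        MemLp a q volume := by
      intro F _ a b q ha hb hab
      have : MemLp (fun x => a x - b x) q volume :=
        ⟨ha.aestronglyMeasurable.sub hb.1, hab.trans_lt (lt_top_iff_ne_top.2 hδ')⟩
      simpa [Pi.add_def] using this.add hb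
    have hw2 : MemLp w 2 volume := mem hws.continuous hu n1
    have hwp : MemLp w (ENNReal.ofReal p) volume := mem hws.continuous hup n2
    have hgw2 : MemLp (gradient w) 2 volume := mem hgws hG (by rw [hgw]; exact n3)
    have c1 := tendsto_eLpNorm_cutoff_smul_sub (f := w) (q := 2) two_pos (by rwa [e2])
    have c2 := tendsto_eLpNorm_cutoff_smul_sub hp0 hwp
    have c3 := tendsto_eLpNorm_gradient_cutoff_mul_sub hws hw2 hgw2
    rw [e2] at c1
    obtain ⟨m, k1, k2, k3⟩ := ((ENNReal.tendsto_nhds_zero.1 c1 δ hδ).and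
      ((ENNReal.tendsto_nhds_zero.1 c2 δ hδ).and (ENNReal.tendsto_nhds_zero.1 c3 δ hδ))).exists
    have hφ : IsTestFunction univ (fun y => cutoff N m y * w y) :=
      ⟨(contDiff_cutoff m).mul hws, (hasCompactSupport_cutoff m).mul_right, subset_univ _⟩
    have tri : ∀ {F : Type} [NormedAddCommGroup F] {a b c : Euc N → F} {q : ℝ≥0∞}, 1 ≤ q →
        Continuous a → Continuous b → AEStronglyMeasurable c volume →
        eLpNorm (fun x => a x - b x) q volume ≤ δ → eLpNorm (fun x => b x - c x) q volume ≤ δ →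
        eLpNorm (fun x => a x - c x) q volume ≤ δ + δ := by
      intro F _ a b c q hq ha hb hc h1 h2
      have e : (fun x => a x - c x) = (fun x => a x - b x) + fun x => b x - c x := by
        funext x; simp
      rw [e]
      exact (eLpNorm_add_le (ha.sub hb).aestronglyMeasurable
        (hb.aestronglyMeasurable.sub hc) hq).trans (add_le_add h1 h2)
    exact ⟨_, hφ, tri (by simp) hφ.continuous hws.continuous hu.1 k1 n1,
      tri hp1 hφ.continuous hws.continuous hup.1 k2 n2,
      tri (by simp) hφ.continuous_gradient hgws hG.1 k3 (by rw [hgw]; exact n3)⟩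
  choose φ hφ b1 b2 b3 using fun n : ℕ => main ((n : ℝ≥0∞) + 1)⁻¹ (by simp)
  have hlim : Tendsto (fun n : ℕ => ((n : ℝ≥0∞) + 1)⁻¹ + ((n : ℝ≥0∞) + 1)⁻¹) atTop (𝓝 0) := by
    have h1 := (tendsto_add_atTop_iff_nat 1).2 ENNReal.tendsto_inv_nat_nhds_zero
    simpa using h1.add h1
  exact ⟨φ, hφ,
    tendsto_of_tendsto_of_tendsto_of_le_of_le tendsto_const_nhds hlim (fun _ => zero_le) b1,
    tendsto_of_tendsto_of_tendsto_of_le_of_le tendsto_const_nhds hlim (fun _ => zero_le) b2,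
    tendsto_of_tendsto_of_tendsto_of_le_of_le tendsto_const_nhds hlim (fun _ => zero_le) b3⟩

theorem tendsto_eLpNorm_of_tendsto_sub {F : Type*} [NormedAddCommGroup F] {q : ℝ≥0∞} (hq : 1 ≤ q)
    {f : ℕ → Euc N → F} {g : Euc N → F} (hf : ∀ n, AEStronglyMeasurable (f n) volume)
    (hg : MemLp g q volume)
    (h : Tendsto (fun n => eLpNorm (fun x => f n x - g x) q volume) atTop (𝓝 0)) :
    Tendsto (fun n => eLpNorm (f n) q volume) atTop (𝓝 (eLpNorm g q volume)) := by
  have hup : Tendsto (fun n => eLpNorm (fun x => f n x - g x) q volume + eLpNorm g q volume) atTop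
      (𝓝 (eLpNorm g q volume)) := by simpa using h.add_const (eLpNorm g q volume)
  have hlow : Tendsto (fun n => eLpNorm g q volume - eLpNorm (fun x => f n x - g x) q volume) atTop
      (𝓝 (eLpNorm g q volume)) := by
    simpa using ENNReal.Tendsto.sub tendsto_const_nhds h (Or.inl hg.2.ne)
  refine tendsto_of_tendsto_of_tendsto_of_le_of_le hlow hup (fun n => ?_) fun n => ?_
  · rw [tsub_le_iff_right]
    have e : g = f n - fun x => f n x - g x := by funext x; simp
    calc eLpNorm g q volume = eLpNorm (f n - fun x => f n x - g x) q volume := by rw [← e]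
      _ ≤ _ := eLpNorm_sub_le (hf n) ((hf n).sub hg.1) hq
  · have e : f n = (fun x => f n x - g x) + g := by funext x; simp
    calc eLpNorm (f n) q volume = eLpNorm ((fun x => f n x - g x) + g) q volume := by rw [← e]
      _ ≤ _ := eLpNorm_add_le ((hf n).sub hg.1) hg.1 hq

/-! ### Translation to infinity and the bound m_ε ≤ m. -/

theorem eLpNorm_const_mul {c : ℝ} (hc : 0 ≤ c) (u : Euc N → ℝ) (q : ℝ≥0∞) :
    eLpNorm (fun x => c * u x) q volume = ENNReal.ofReal c * eLpNorm u q volume := by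
  rw [← Real.enorm_eq_ofReal hc]
  exact eLpNorm_const_smul c u q volume

theorem HasWeakGradient.sobolevSq_const_mul {u : Euc N → ℝ} {G : Euc N → Euc N}
    (h : HasWeakGradient u G) {c : ℝ} (hc : 0 ≤ c) :
    sobolevSq (fun x => c * u x) = ENNReal.ofReal c ^ 2 * sobolevSq u := by
  have h1 : eLpNorm (fun x => c • G x) 2 volume = ENNReal.ofReal c * eLpNorm G 2 volume := by
    rw [← Real.enorm_eq_ofReal hc]; exact eLpNorm_const_smul c G 2 volume
  rw [(h.const_mul c).sobolevSq_eq, h.sobolevSq_eq, h1, eLpNorm_const_mul hc]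
  ring

/-- In the original scale one needs a ball of radius εM in Ω far from the origin; the enlarging
condition supplies a larger ball through a remote point x, but its centre may lie near the origin,
so a smaller ball close to x is cut out of it. -/
theorem exists_far_ball {Ω : Set (Euc N)} (hunb : ¬ Bornology.IsBounded Ω)
    (hC : EnlargesAtInfinity Ω) {ε : ℝ} (hε : 0 < ε) {M : ℝ} (hM : 0 < M) (R : ℝ) :
    ∃ y : Euc N, R ≤ ‖y‖ ∧ Metric.ball y M ⊆ rescale Ω ε := by
  have hM' : 0 < ε * M := by positivity
  have hev := hC.eventually (lt_mem_nhds (ENNReal.ofReal_lt_top (r := ε * M)))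
  obtain ⟨R₀, hR₀⟩ := eventually_atTop.1 hev
  -- The summand εM in the threshold pays for moving from x to the new centre z.
  obtain ⟨x, hxΩ, hx⟩ : ∃ x ∈ Ω, max R₀ (ε * R + ε * M) < ‖x‖ := by
    by_contra hcon
    push Not at hcon
    exact hunb (isBounded_iff_forall_norm_le.2 ⟨_, hcon⟩)
  have h1 := (hR₀ ‖x‖ ((le_max_left _ _).trans hx.le)).trans_le
    (sInf_le (mem_image_of_mem _ (show x ∈ {z | z ∈ Ω ∧ ‖z‖ = ‖x‖} from ⟨hxΩ, rfl⟩)))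
  obtain ⟨_, ⟨ρ, ⟨hρ, c, hcΩ, hxc, hball⟩, rfl⟩, hlt⟩ := lt_sSup_iff.1 h1
  rw [ENNReal.ofReal_lt_ofReal_iff hρ] at hlt
  -- Move from x towards c by the length εM, or stop at c if it is closer. The ball of radius εM
  -- about z then still lies in the ball of radius ρ about c.
  obtain ⟨z, hz1, hz2⟩ : ∃ z : Euc N, ‖x - z‖ ≤ ε * M ∧ ‖z - c‖ ≤ ρ - ε * M := by
    have hxc' : ‖x - c‖ < ρ := by simpa [dist_eq_norm] using hxc
    by_cases hd : ‖x - c‖ ≤ ε * M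
    · exact ⟨c, hd, by simpa using hlt.le⟩
    · push Not at hd
      have hd0 : 0 < ‖x - c‖ := hM'.trans hd
      refine ⟨x - (ε * M / ‖x - c‖) • (x - c), ?_, ?_⟩
      · rw [sub_sub_cancel, norm_smul, Real.norm_of_nonneg (by positivity),
          div_mul_cancel₀ _ hd0.ne']
      · have e : x - (ε * M / ‖x - c‖) • (x - c) - c = (1 - ε * M / ‖x - c‖) • (x - c) := by
          rw [sub_smul, one_smul]; abel
        have hle : ε * M / ‖x - c‖ ≤ 1 := (div_le_one hd0).2 hd.le
        rw [e, norm_smul, Real.norm_of_nonneg (by linarith), sub_mul, div_mul_cancel₀ _ hd0.ne']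
        linarith
  refine ⟨ε⁻¹ • z, ?_, fun w hw => hball ?_⟩
  · rw [norm_smul, norm_inv, Real.norm_of_nonneg hε.le, le_inv_mul_iff₀ hε]
    have h3 : ‖x‖ ≤ ‖x - z‖ + ‖z‖ := by simpa using norm_add_le (x - z) z
    linarith [(le_max_right R₀ (ε * R + ε * M)).trans hx.le]
  · have hw' : ‖ε • w - z‖ < ε * M := by
      have e : ε • w - z = ε • (w - ε⁻¹ • z) := by
        rw [smul_sub, smul_inv_smul₀ hε.ne']
      rw [e, norm_smul, Real.norm_of_nonneg hε.le]
      have : ‖w - ε⁻¹ • z‖ < M := by simpa [dist_eq_norm] using hw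
      gcongr
    rw [Metric.mem_ball, dist_eq_norm]
    have h4 : ‖ε • w - c‖ ≤ ‖ε • w - z‖ + ‖z - c‖ := by
      simpa using norm_add_le (ε • w - z) (z - c)
    linarith

theorem tendsto_lintegral_far {α : Euc N → ℝ} (hα : Integrable α) :
    Tendsto (fun k : ℕ => ∫⁻ x, {x : Euc N | (k : ℝ) ≤ ‖x‖}.indicator (fun x => ‖α x‖ₑ) x)
      atTop (𝓝 0) := by
  have h := tendsto_lintegral_of_dominated_convergence' (μ := (volume : Measure (Euc N)))
    (F := fun (k : ℕ) x => {x : Euc N | (k : ℝ) ≤ ‖x‖}.indicator (fun x => ‖α x‖ₑ) x)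
    (f := fun _ => 0) (fun x => ‖α x‖ₑ)
    (fun k => hα.1.enorm.indicator (measurableSet_le measurable_const measurable_norm))
    (fun k => ae_of_all _ fun x => indicator_le_self _ _ x) hα.2.ne
    (ae_of_all _ fun x => ?_)
  · simpa using h
  · obtain ⟨k, hk⟩ := exists_nat_gt ‖x‖
    refine tendsto_const_nhds.congr' ?_
    filter_upwards [eventually_ge_atTop k] with m hm
    rw [indicator_of_notMem]
    have : (k : ℝ) ≤ m := by exact_mod_cast hm
    simp only [mem_ofPred_eq, not_le]
    linarith

/-- For a bounded function the cost of the potential is controlled by the mass of α on the support,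
a quantity that disappears under translation to infinity. -/
theorem energy_le {α : Euc N → ℝ} {D : Set (Euc N)} {φ : Euc N → ℝ} (h : IsTestFunction D φ)
    {B : ℝ} (hB : ∀ x, ‖φ x‖ ≤ B) {s : Set (Euc N)} (hs : Function.support φ ⊆ s) :
    energy α φ ≤ sobolevSq φ +
      ENNReal.ofReal (B ^ 2) * ∫⁻ x, s.indicator (fun x => ‖α x‖ₑ) x := by
  rw [← lintegral_const_mul' _ _ ENNReal.ofReal_ne_top, sobolevSq, ← lintegral_add_left']
  · refine lintegral_mono fun x => ?_
    have e : ‖weakGradient φ x‖ ^ 2 + (1 + α x) * φ x ^ 2 =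
        (‖weakGradient φ x‖ ^ 2 + φ x ^ 2) + φ x ^ 2 * α x := by ring
    simp only [e]
    refine ENNReal.ofReal_add_le.trans (add_le_add le_rfl ?_)
    by_cases hx : x ∈ s
    · rw [indicator_of_mem hx, ENNReal.ofReal_mul (sq_nonneg _)]
      gcongr ENNReal.ofReal ?_ * ?_
      · rw [← sq_abs, ← Real.norm_eq_abs]
        exact pow_le_pow_left₀ (norm_nonneg _) (hB x) 2
      · exact Real.ofReal_le_enorm _
    · have : φ x = 0 := by
        by_contra h0
        exact hx (hs h0)
      simp [this]
  · have h1 := h.memH1.memLp_weakGradient.1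
    exact ((h1.norm.aemeasurable.pow_const 2).add
      (h.continuous.measurable.aemeasurable.pow_const 2)).ennreal_ofReal

theorem IsTestFunction.sobolevSq_comp_sub {D : Set (Euc N)} {φ : Euc N → ℝ}
    (h : IsTestFunction D φ) (y : Euc N) : sobolevSq (fun x => φ (x - y)) = sobolevSq φ := by
  have h1 := h.comp_sub_right y (D' := univ) (fun _ _ => mem_univ _)
  rw [(hasWeakGradient_gradient h1.1).sobolevSq_eq, (hasWeakGradient_gradient h.1).sobolevSq_eq]
  have e : gradient (fun x => φ (x - y)) = gradient φ ∘ fun x => x - y := by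
    funext x; exact gradient_comp_sub_right φ y x
  have e' : (fun x => φ (x - y)) = φ ∘ fun x => x - y := rfl
  have mp := measurePreserving_sub_right (volume : Measure (Euc N)) y
  rw [e, eLpNorm_comp_measurePreserving h.continuous_gradient.aestronglyMeasurable mp, e',
    eLpNorm_comp_measurePreserving h.continuous.aestronglyMeasurable mp]

theorem mEps_le_sobolevSq_of_eLpNorm_eq_one {Ω : Set (Euc N)} (hunb : ¬ Bornology.IsBounded Ω)
    (hC : EnlargesAtInfinity Ω) {α : Euc N → ℝ} (hα : Integrable α) {ε : ℝ} (hε : 0 < ε) {p : ℝ}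
    {φ : Euc N → ℝ} (hφ : IsTestFunction univ φ) (h1 : eLpNorm φ (ENNReal.ofReal p) volume = 1) :
    mEps Ω α p ε ≤ sobolevSq φ := by
  obtain ⟨B, hB⟩ := hφ.2.1.exists_bound_of_continuous hφ.continuous
  obtain ⟨M, hM0, hM⟩ := hφ.2.1.isCompact.isBounded.subset_ball_lt 0 0
  -- At distance k + M the translated support, of radius M, stays outside the ball of radius k.
  choose y hy hball using fun k : ℕ => exists_far_ball hunb hC hε hM0 (k + M)
  have hlim : Tendsto (fun k : ℕ => sobolevSq φ + ENNReal.ofReal (B ^ 2) *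
      ∫⁻ x, {x : Euc N | (k : ℝ) ≤ ‖x‖}.indicator (fun x => ‖α x‖ₑ) x) atTop
      (𝓝 (sobolevSq φ)) := by
    have h2 := ENNReal.Tendsto.const_mul (a := ENNReal.ofReal (B ^ 2)) (tendsto_lintegral_far hα)
      (Or.inr ENNReal.ofReal_ne_top)
    simpa using h2.const_add (sobolevSq φ)
  refine ge_of_tendsto' hlim fun k => ?_
  have hφ' : IsTestFunction (Metric.ball 0 M) φ := ⟨hφ.1, hφ.2.1, hM⟩
  have hk : IsTestFunction (rescale Ω ε) (fun x => φ (x - y k)) := by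
    refine hφ'.comp_sub_right (y k) fun x hx => hball k ?_
    simpa [dist_eq_norm] using hx
  rw [← hφ.sobolevSq_comp_sub (y k)]
  refine le_trans (sInf_le (mem_image_of_mem _ ⟨hk.memH10, ?_⟩))
    (energy_le hk (fun x => hB _) fun x hx => ?_)
  · rw [← h1]
    exact eLpNorm_comp_measurePreserving hφ.continuous.aestronglyMeasurable
      (measurePreserving_sub_right (volume : Measure (Euc N)) (y k))
  · have h3 : x - y k ∈ Metric.ball (0 : Euc N) M := hM (subset_tsupport φ hx)
    rw [mem_ball_zero_iff] at h3
    have h4 : ‖y k‖ ≤ ‖x‖ + ‖x - y k‖ := by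
      simpa using norm_sub_le x (x - y k)
    simp only [mem_ofPred_eq]
    linarith [hy k]

/-- The homogeneous form is the one that survives approximation, since test functions approximating
a competitor need not have L^p norm exactly 1. -/
theorem mEps_mul_le_sobolevSq {Ω : Set (Euc N)} (hunb : ¬ Bornology.IsBounded Ω)
    (hC : EnlargesAtInfinity Ω) {α : Euc N → ℝ} (hα : Integrable α) {ε : ℝ} (hε : 0 < ε) {p : ℝ}
    {φ : Euc N → ℝ} (hφ : IsTestFunction univ φ) :
    mEps Ω α p ε * eLpNorm φ (ENNReal.ofReal p) volume ^ 2 ≤ sobolevSq φ := by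
  set l := eLpNorm φ (ENNReal.ofReal p) volume with hl
  by_cases h0 : l = 0
  · simp [h0]
  have htop : l ≠ ⊤ := (hφ.memLp _).2.ne
  have hinv : ENNReal.ofReal l.toReal⁻¹ = l⁻¹ := by
    rw [ENNReal.ofReal_inv_of_pos (ENNReal.toReal_pos h0 htop), ENNReal.ofReal_toReal htop]
  have hpos : 0 ≤ l.toReal⁻¹ := by positivity
  have hone : eLpNorm (fun x => l.toReal⁻¹ * φ x) (ENNReal.ofReal p) volume = 1 := by
    rw [eLpNorm_const_mul hpos, hinv, ENNReal.inv_mul_cancel h0 htop]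
  have h := mEps_le_sobolevSq_of_eLpNorm_eq_one hunb hC hα hε (hφ.const_mul l.toReal⁻¹) hone
  rw [(hasWeakGradient_gradient hφ.1).sobolevSq_const_mul hpos, hinv] at h
  calc mEps Ω α p ε * l ^ 2 ≤ l⁻¹ ^ 2 * sobolevSq φ * l ^ 2 := by gcongr
    _ = (l⁻¹ * l) ^ 2 * sobolevSq φ := by ring
    _ = sobolevSq φ := by rw [ENNReal.inv_mul_cancel h0 htop, one_pow, one_mul]

theorem mEps_le_mWhole {Ω : Set (Euc N)} (hunb : ¬ Bornology.IsBounded Ω)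
    (hC : EnlargesAtInfinity Ω) {α : Euc N → ℝ} (hα : Integrable α) {ε : ℝ} (hε : 0 < ε) {p : ℝ}
    (hp : 1 ≤ p) : mEps Ω α p ε ≤ mWhole N p := by
  rw [mWhole_eq]
  refine le_sInf ?_
  rintro _ ⟨u, ⟨hu, hu1⟩, rfl⟩
  have hG := hu.hasWeakGradient
  have hup : MemLp u (ENNReal.ofReal p) volume := ⟨hu.1.1, by rw [hu1]; simp⟩
  obtain ⟨φ, hφ, l1, l2, l3⟩ := hG.exists_tendsto_test hu.1 hu.memLp_weakGradient hp hup
  have t1 := tendsto_eLpNorm_of_tendsto_sub (by simp)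
    (fun n => (hφ n).continuous.aestronglyMeasurable) hu.1 l1
  have t2 := tendsto_eLpNorm_of_tendsto_sub (by simpa using hp)
    (fun n => (hφ n).continuous.aestronglyMeasurable) hup l2
  have t3 := tendsto_eLpNorm_of_tendsto_sub (by simp)
    (fun n => (hφ n).continuous_gradient.aestronglyMeasurable) hu.memLp_weakGradient l3
  have hS : Tendsto (fun n => sobolevSq (φ n)) atTop (𝓝 (sobolevSq u)) := by
    rw [hG.sobolevSq_eq]
    simp only [(hasWeakGradient_gradient (hφ _).1).sobolevSq_eq]
    exact (ENNReal.Tendsto.pow t3).add (ENNReal.Tendsto.pow t1)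
  have hL : Tendsto (fun n => mEps Ω α p ε * eLpNorm (φ n) (ENNReal.ofReal p) volume ^ 2) atTop
      (𝓝 (mEps Ω α p ε)) := by
    rw [hu1] at t2
    -- The limit of the norms is 1, not 0, so the product is continuous there without knowing that
    -- `mEps` is finite.
    have := ENNReal.Tendsto.const_mul (a := mEps Ω α p ε) (ENNReal.Tendsto.pow (n := 2) t2) (Or.inl (by simp))
    simpa using this
  exact le_of_tendsto_of_tendsto' hL hS fun n => mEps_mul_le_sobolevSq hunb hC hα hε (hφ n)

/-! ### The bound m ≤ m_ε and integrability of the potential. -/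

theorem sobolevSq_le_energy {α : Euc N → ℝ} (hα : ∀ᵐ x, 0 ≤ α x) (u : Euc N → ℝ) :
    sobolevSq u ≤ energy α u := by
  refine lintegral_mono_ae ?_
  filter_upwards [hα] with x hx
  refine ENNReal.ofReal_le_ofReal ?_
  nlinarith [mul_nonneg hx (sq_nonneg (u x))]

theorem mWhole_le_mEps {Ω : Set (Euc N)} {α : Euc N → ℝ} (hα : ∀ᵐ x, 0 ≤ α x) {p ε : ℝ} :
    mWhole N p ≤ mEps Ω α p ε := by
  refine le_sInf ?_
  rintro _ ⟨u, hu, rfl⟩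
  exact (sInf_le (mem_image_of_mem sobolevSq
    (show u ∈ {u | MemH1 u ∧ eLpNorm u (ENNReal.ofReal p) volume = 1} from
      ⟨hu.1.1, hu.2⟩))).trans (sobolevSq_le_energy hα u)

/-- The weight is at least 1, so the decay assumption puts α in L^1, as needed for the tails of α in
the translation argument. -/
theorem integrable_of_weighted {α : Euc N → ℝ} (hm : AEStronglyMeasurable α volume) {s : ℝ}
    (h : Integrable fun x => α x * Real.exp (2 * ‖x‖) * (1 + ‖x‖ ^ s)) : Integrable α := by
  refine h.mono hm (ae_of_all _ fun x => ?_)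
  have h1 : 1 ≤ Real.exp (2 * ‖x‖) := Real.one_le_exp (by positivity)
  have h2 : 1 ≤ 1 + ‖x‖ ^ s := by linarith [Real.rpow_nonneg (norm_nonneg x) s]
  rw [norm_mul, norm_mul, mul_assoc, Real.norm_of_nonneg (zero_le_one.trans h1),
    Real.norm_of_nonneg (zero_le_one.trans h2)]
  exact le_mul_of_one_le_right (norm_nonneg _) (one_le_mul_of_one_le_of_one_le h1 h2)

/-! ### Chain rule and absolute value in H^1. -/

theorem MemH1.exists_tendsto_test_ae {u : Euc N → ℝ} (hu : MemH1 u) :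
    ∃ φ : ℕ → Euc N → ℝ, (∀ n, IsTestFunction univ (φ n)) ∧
      Tendsto (fun n => eLpNorm (fun x => φ n x - u x) 2 volume) atTop (𝓝 0) ∧
      Tendsto (fun n => eLpNorm (fun x => gradient (φ n) x - weakGradient u x) 2 volume)
        atTop (𝓝 0) ∧
      ∀ᵐ x, Tendsto (fun n => φ n x) atTop (𝓝 (u x)) := by
  have e2 : ENNReal.ofReal 2 = 2 := by simp
  obtain ⟨φ, hφ, l1, -, l3⟩ := hu.hasWeakGradient.exists_tendsto_test hu.1 hu.memLp_weakGradient
    (p := 2) one_le_two (by rw [e2]; exact hu.1)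
  have hm := tendstoInMeasure_of_tendsto_eLpNorm (p := 2) (by simp)
    (fun n => (hφ n).continuous.aestronglyMeasurable) hu.1.1 l1
  obtain ⟨k, hk, hae⟩ := hm.exists_seq_tendsto_ae
  exact ⟨fun n => φ (k n), fun n => hφ _, l1.comp hk.tendsto_atTop, l3.comp hk.tendsto_atTop, hae⟩

theorem tendsto_integral_smul_zero_of_eLpNorm_two {F : Type*} [NormedAddCommGroup F]
    [NormedSpace ℝ F] {a : ℕ → Euc N → ℝ} {V : ℕ → Euc N → F} {C : ℝ≥0∞} (hC : C ≠ ⊤)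
    (ha : ∀ n, AEStronglyMeasurable (a n) volume) (haC : ∀ n, eLpNorm (a n) 2 volume ≤ C)
    (hV : ∀ n, AEStronglyMeasurable (V n) volume)
    (hVW : Tendsto (fun n => eLpNorm (V n) 2 volume) atTop (𝓝 0))
    (hi : ∀ n, Integrable (fun x => a n x • V n x)) :
    Tendsto (fun n => ∫ x, a n x • V n x) atTop (𝓝 0) := by
  rw [← integral_zero (Euc N) F]
  refine tendsto_integral_of_L1 _ aestronglyMeasurable_const (Eventually.of_forall hi) ?_
  have hlim : Tendsto (fun n => C * eLpNorm (V n) 2 volume) atTop (𝓝 0) := by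
    simpa using ENNReal.Tendsto.const_mul hVW (Or.inr hC)
  refine tendsto_of_tendsto_of_tendsto_of_le_of_le tendsto_const_nhds hlim (fun _ => zero_le)
    fun n => ?_
  simp only [sub_zero]
  have h := eLpNorm_smul_le_mul_eLpNorm (p := 2) (q := 2) (r := 1) (hV n) (ha n)
  rw [eLpNorm_one_eq_lintegral_enorm] at h
  exact h.trans (mul_le_mul_left (haC n) _)

theorem gradient_comp {F F' : ℝ → ℝ} (hF : ∀ s, HasDerivAt F (F' s) s) {φ : Euc N → ℝ}
    {x : Euc N} (hφ : DifferentiableAt ℝ φ x) :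
    gradient (fun y => F (φ y)) x = F' (φ x) • gradient φ x := by
  have h := (hF (φ x)).comp_hasFDerivAt x hφ.hasFDerivAt
  have e : fderiv ℝ (fun y => F (φ y)) x = F' (φ x) • fderiv ℝ φ x := h.fderiv
  rw [gradient, gradient, e, map_smul]

/-- The chain rule in `H^1` for a smooth function with derivative bounded by `1`. -/
theorem MemH1.hasWeakGradient_comp {u : Euc N → ℝ} (hu : MemH1 u) {F F' : ℝ → ℝ}
    (hFs : ContDiff ℝ ∞ F) (hF : ∀ s, HasDerivAt F (F' s) s) (hc : Continuous F')
    (hb : ∀ s, |F' s| ≤ 1) :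
    HasWeakGradient (fun x => F (u x)) (fun x => F' (u x) • weakGradient u x) := by
  have hLip : ∀ s t, |F s - F t| ≤ |s - t| := by
    intro s t
    have := convex_univ.norm_image_sub_le_of_norm_hasDerivWithin_le (C := 1)
      (fun x _ => (hF x).hasDerivWithinAt) (fun x _ => hb x) (mem_univ t) (mem_univ s)
    simpa using this
  have hG := hu.memLp_weakGradient
  -- F(0) need not vanish, as for √(s² + δ²), so only F(u) - F(0) is controlled in L^2.
  have hFu : LocallyIntegrable (fun x => F (u x)) := by
    have h1 : MemLp (fun x => F (u x) - F 0) 2 volume := by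
      refine hu.1.mono ((hFs.continuous.comp_aestronglyMeasurable hu.1.1).sub
        aestronglyMeasurable_const) (ae_of_all _ fun x => ?_)
      simpa using hLip (u x) 0
    have h2 := (h1.locallyIntegrable (by simp)).add (locallyIntegrable_const (F 0))
    simpa [Pi.add_def] using h2
  have hFG : MemLp (fun x => F' (u x) • weakGradient u x) 2 volume := by
    refine hG.mono ((hc.comp_aestronglyMeasurable hu.1.1).smul hG.1) (ae_of_all _ fun x => ?_)
    rw [norm_smul]
    exact mul_le_of_le_one_left (norm_nonneg _) (hb _)
  refine ⟨hFu, hFG.locallyIntegrable (by simp), fun ψ hψ => ?_⟩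
  obtain ⟨φ, hφ, l1, l3, hae⟩ := hu.exists_tendsto_test_ae
  have hψc := hasCompactSupport_gradient hψ.2.1
  have key : ∀ n, ∫ x, F (φ n x) • gradient ψ x
      = - ∫ x, ψ x • (F' (φ n x) • gradient (φ n) x) := by
    intro n
    have := (hasWeakGradient_gradient (hFs.comp (hφ n).1)).2.2 ψ hψ
    simp only [Function.comp_def] at this
    rw [this]
    congr 2
    funext x
    rw [gradient_comp hF ((hφ n).1.differentiable (by simp) x)]
  have L : Tendsto (fun n => ∫ x, F (φ n x) • gradient ψ x) atTop
      (𝓝 (∫ x, F (u x) • gradient ψ x)) := by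
    have hi : Integrable (fun x => F (u x) • gradient ψ x) :=
      integrable_smul_of_test' hψ.continuous_gradient hψc hFu
    have hi' : ∀ n, Integrable (fun x => F (φ n x) • gradient ψ x) := fun n =>
      integrable_smul_of_test' hψ.continuous_gradient hψc
        (hFs.continuous.comp (hφ n).continuous).locallyIntegrable
    refine tendsto_integral_of_L1 _ hi.1 (Eventually.of_forall hi') ?_
    have hlim : Tendsto (fun n => eLpNorm (fun x => φ n x - u x) 2 volume *
        eLpNorm (gradient ψ) 2 volume) atTop (𝓝 0) := by
      simpa using ENNReal.Tendsto.mul_const l1 (Or.inr (hψ.memLp_gradient 2).2.ne)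
    refine tendsto_of_tendsto_of_tendsto_of_le_of_le tendsto_const_nhds hlim (fun _ => zero_le)
      fun n => ?_
    have h := eLpNorm_smul_le_mul_eLpNorm (p := 2) (q := 2) (r := 1)
      (hψ.memLp_gradient (N := N) 2).1
      ((hφ n).continuous.aestronglyMeasurable.sub hu.1.1 : AEStronglyMeasurable
        (fun x => φ n x - u x) volume)
    rw [eLpNorm_one_eq_lintegral_enorm] at h
    refine le_trans (lintegral_mono fun x => ?_) h
    simp only [← sub_smul, Pi.smul_apply', enorm_smul]
    gcongr
    rw [enorm_le_iff_norm_le]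
    exact hLip _ _
  -- Split F'(φ_n)∇φ_n into F'(φ_n)∇u, handled by dominated convergence, and F'(φ_n)(∇φ_n - ∇u),
  -- which vanishes in the limit by Cauchy–Schwarz.
  have R1 : Tendsto (fun n => ∫ x, (ψ x * F' (φ n x)) • weakGradient u x) atTop
      (𝓝 (∫ x, ψ x • (F' (u x) • weakGradient u x))) := by
    refine tendsto_integral_of_dominated_convergence (fun x => ‖ψ x • weakGradient u x‖)
      (fun n => ?_) ?_ (fun n => ae_of_all _ fun x => ?_) ?_
    · exact (hψ.continuous.mul (hc.comp (hφ n).continuous)).aestronglyMeasurable.smul hG.1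
    · exact (integrable_smul_of_test hψ.continuous hψ.2.1 (hG.locallyIntegrable (by simp))).norm
    · rw [norm_smul, norm_smul, norm_mul]
      gcongr
      exact mul_le_of_le_one_right (norm_nonneg _) (hb _)
    · filter_upwards [hae] with x hx
      simp only [← mul_smul]
      exact (((hc.tendsto _).comp hx).const_mul (ψ x)).smul_const _
  have R2 : Tendsto (fun n => ∫ x, (ψ x * F' (φ n x)) •
      (gradient (φ n) x - weakGradient u x)) atTop (𝓝 0) := by
    have hm : ∀ n, Continuous fun x => ψ x * F' (φ n x) := fun n =>
      hψ.continuous.mul (hc.comp (hφ n).continuous)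
    have hV : ∀ n, MemLp (fun x => gradient (φ n) x - weakGradient u x) 2 volume := fun n =>
      ((hφ n).memLp_gradient 2).sub hG
    refine tendsto_integral_smul_zero_of_eLpNorm_two (C := eLpNorm ψ 2 volume)
      (hψ.memLp 2).2.ne (fun n => (hm n).aestronglyMeasurable) (fun n => ?_)
      (fun n => (hV n).1) l3 fun n => ?_
    · refine eLpNorm_mono fun x => ?_
      rw [norm_mul]
      exact mul_le_of_le_one_right (norm_nonneg _) (hb _)
    · exact integrable_smul_of_test (hm n) hψ.2.1.mul_right
        ((hV n).locallyIntegrable (by simp))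
  have R : Tendsto (fun n => ∫ x, ψ x • (F' (φ n x) • gradient (φ n) x)) atTop
      (𝓝 (∫ x, ψ x • (F' (u x) • weakGradient u x))) := by
    have h := R1.add R2
    rw [add_zero] at h
    refine h.congr fun n => ?_
    have hm : Continuous fun x => ψ x * F' (φ n x) :=
      hψ.continuous.mul (hc.comp (hφ n).continuous)
    rw [← integral_add]
    · refine integral_congr_ae (ae_of_all _ fun x => ?_)
      simp only [mul_smul, smul_sub]
      abel
    · exact integrable_smul_of_test hm hψ.2.1.mul_right (hG.locallyIntegrable (by simp))
    · exact integrable_smul_of_test hm hψ.2.1.mul_right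
        ((((hφ n).memLp_gradient 2).sub hG).locallyIntegrable (by simp))
  exact tendsto_nhds_unique (L.congr key) R.neg

theorem norm_div_abs_le_one (s : ℝ) : ‖s / |s|‖ ≤ 1 := by
  rw [norm_div, Real.norm_eq_abs, Real.norm_eq_abs, abs_abs]
  exact div_self_le_one _

theorem MemH1.memLp_abs_grad {u : Euc N → ℝ} (hu : MemH1 u) :
    MemLp (fun x => (u x / |u x|) • weakGradient u x) 2 volume := by
  have hm : AEStronglyMeasurable (fun x => u x / |u x|) volume :=
    (hu.1.1.aemeasurable.div (continuous_abs.measurable.comp_aemeasurable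
      hu.1.1.aemeasurable)).aestronglyMeasurable
  refine hu.memLp_weakGradient.mono (hm.smul hu.memLp_weakGradient.1) (ae_of_all _ fun x => ?_)
  rw [norm_smul]
  exact mul_le_of_le_one_left (norm_nonneg _) (norm_div_abs_le_one _)

theorem tendsto_sqrt_sq_add (s : ℝ) :
    Tendsto (fun n : ℕ => √(s ^ 2 + ((n : ℝ) + 1)⁻¹ ^ 2)) atTop (𝓝 |s|) := by
  have h : Tendsto (fun n : ℕ => ((n : ℝ) + 1)⁻¹) atTop (𝓝 0) := by
    simpa [one_div] using tendsto_one_div_add_atTop_nhds_zero_nat (𝕜 := ℝ)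
  have := ((h.pow 2).const_add (s ^ 2)).sqrt
  simpa [Real.sqrt_sq_eq_abs] using this

/-- The weak gradient of `|u|`. -/
theorem MemH1.hasWeakGradient_abs {u : Euc N → ℝ} (hu : MemH1 u) :
    HasWeakGradient (fun x => |u x|) (fun x => (u x / |u x|) • weakGradient u x) := by
  have hG := hu.memLp_weakGradient
  refine ⟨(hu.1.abs).locallyIntegrable (by simp), hu.memLp_abs_grad.locallyIntegrable (by simp),
    fun ψ hψ => ?_⟩
  have hψc := hasCompactSupport_gradient hψ.2.1
  have hd : ∀ n : ℕ, (0 : ℝ) < ((n : ℝ) + 1)⁻¹ := fun n => by positivity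
  have hpos : ∀ (n : ℕ) (s : ℝ), 0 < s ^ 2 + ((n : ℝ) + 1)⁻¹ ^ 2 := fun n s => by
    have := hd n; positivity
  have hle : ∀ (n : ℕ) (s : ℝ), |s| ≤ √(s ^ 2 + ((n : ℝ) + 1)⁻¹ ^ 2) := fun n s =>
    Real.abs_le_sqrt (by nlinarith [sq_nonneg ((n : ℝ) + 1)⁻¹])
  have hb : ∀ (n : ℕ) (s : ℝ), |s / √(s ^ 2 + ((n : ℝ) + 1)⁻¹ ^ 2)| ≤ 1 := fun n s => by
    rw [abs_div, abs_of_nonneg (Real.sqrt_nonneg _)]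
    exact div_le_one_of_le₀ (hle n s) (Real.sqrt_nonneg _)
  have hcont : ∀ n : ℕ, Continuous fun s : ℝ => √(s ^ 2 + ((n : ℝ) + 1)⁻¹ ^ 2) := fun n => by
    fun_prop
  have hcont' : ∀ n : ℕ, Continuous fun s : ℝ => s / √(s ^ 2 + ((n : ℝ) + 1)⁻¹ ^ 2) := fun n =>
    continuous_id.div (hcont n) fun s => (Real.sqrt_pos.2 (hpos n s)).ne'
  have key : ∀ n : ℕ, ∫ x, √(u x ^ 2 + ((n : ℝ) + 1)⁻¹ ^ 2) • gradient ψ x =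
      - ∫ x, ψ x • ((u x / √(u x ^ 2 + ((n : ℝ) + 1)⁻¹ ^ 2)) • weakGradient u x) := by
    -- The modulus is regularized as √(s² + δ²) with δ = 1/(n + 1), a smooth function whose
    -- derivative is bounded by 1.
    intro n
    refine (hu.hasWeakGradient_comp (F := fun s => √(s ^ 2 + ((n : ℝ) + 1)⁻¹ ^ 2))
      (F' := fun s => s / √(s ^ 2 + ((n : ℝ) + 1)⁻¹ ^ 2)) ?_ (fun s => ?_) (hcont' n)
      (hb n)).2.2 ψ hψ
    · exact ((contDiff_id.pow 2).add contDiff_const).sqrt fun s => (hpos n s).ne'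
    · have h := ((hasDerivAt_pow 2 s).add_const (((n : ℝ) + 1)⁻¹ ^ 2)).sqrt (hpos n s).ne'
      convert h using 1
      field_simp
      simp [mul_comm]
  have L : Tendsto (fun n : ℕ => ∫ x, √(u x ^ 2 + ((n : ℝ) + 1)⁻¹ ^ 2) • gradient ψ x) atTop
      (𝓝 (∫ x, |u x| • gradient ψ x)) := by
    refine tendsto_integral_of_dominated_convergence (fun x => ‖(|u x| + 1) • gradient ψ x‖)
      (fun n => ?_) ?_ (fun n => ae_of_all _ fun x => ?_) (ae_of_all _ fun x => ?_)
    · exact ((hcont n).comp_aestronglyMeasurable hu.1.1).smul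
        hψ.continuous_gradient.aestronglyMeasurable
    · exact (integrable_smul_of_test' hψ.continuous_gradient hψc
        (((hu.1.abs).locallyIntegrable (by simp)).add (locallyIntegrable_const 1))).norm
    · rw [norm_smul, norm_smul]
      gcongr
      rw [Real.norm_of_nonneg (Real.sqrt_nonneg _), Real.norm_of_nonneg (by positivity)]
      have h1 : ((n : ℝ) + 1)⁻¹ ≤ 1 := inv_le_one_of_one_le₀ (by simp)
      rw [Real.sqrt_le_left (by positivity)]
      nlinarith [abs_nonneg (u x), sq_abs (u x), hd n]
    · exact (tendsto_sqrt_sq_add (u x)).smul_const _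
  have R : Tendsto (fun n : ℕ => ∫ x, ψ x •
      ((u x / √(u x ^ 2 + ((n : ℝ) + 1)⁻¹ ^ 2)) • weakGradient u x)) atTop
      (𝓝 (∫ x, ψ x • ((u x / |u x|) • weakGradient u x))) := by
    refine tendsto_integral_of_dominated_convergence (fun x => ‖ψ x • weakGradient u x‖)
      (fun n => ?_) ?_ (fun n => ae_of_all _ fun x => ?_) (ae_of_all _ fun x => ?_)
    · exact hψ.continuous.aestronglyMeasurable.smul
        (((hcont' n).comp_aestronglyMeasurable hu.1.1).smul hG.1)
    · exact (integrable_smul_of_test hψ.continuous hψ.2.1 (hG.locallyIntegrable (by simp))).norm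
    · rw [norm_smul, norm_smul, norm_smul]
      gcongr
      exact mul_le_of_le_one_left (norm_nonneg _) (hb _ _)
    · refine Tendsto.const_smul (Tendsto.smul_const ?_ _) _
      -- At zeros of u both quotients are 0, by the convention 0/0 = 0 in the limit.
      by_cases h0 : u x = 0
      · simp [h0]
      · exact tendsto_const_nhds.div (tendsto_sqrt_sq_add (u x)) (abs_ne_zero.2 h0)
  exact tendsto_nhds_unique (L.congr key) R.neg

theorem MemH1.abs {u : Euc N → ℝ} (hu : MemH1 u) : MemH1 fun x => |u x| :=
  ⟨hu.1.abs, _, hu.hasWeakGradient_abs, hu.memLp_abs_grad⟩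

/-- The sign factor has modulus at most 1; hence the absolute value of a minimizer is a minimizer.
-/
theorem MemH1.sobolevSq_abs_le {u : Euc N → ℝ} (hu : MemH1 u) :
    sobolevSq (fun x => |u x|) ≤ sobolevSq u := by
  rw [hu.hasWeakGradient_abs.sobolevSq_eq, hu.hasWeakGradient.sobolevSq_eq]
  gcongr ?_ ^ 2 + ?_ ^ 2
  · refine eLpNorm_mono fun x => ?_
    rw [norm_smul]
    exact mul_le_of_le_one_left (norm_nonneg _) (norm_div_abs_le_one _)
  · exact eLpNorm_mono fun x => by simp

/-! ### Minimizers are weak supersolutions. -/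

/-- `v`, with weak gradient `G`, satisfies `-Δv + v ≥ 0` in the weak sense. -/
def IsWeakSupersolution (v : Euc N → ℝ) (G : Euc N → Euc N) : Prop :=
  ∀ φ : Euc N → ℝ, IsTestFunction univ φ → (∀ x, 0 ≤ φ x) →
    0 ≤ ∫ x, (⟪G x, gradient φ x⟫ + v x * φ x)

theorem mWhole_mul_le_sobolevSq {p : ℝ} {w : Euc N → ℝ} (hw : MemH1 w)
    (hwp : eLpNorm w (ENNReal.ofReal p) volume ≠ ⊤) :
    mWhole N p * eLpNorm w (ENNReal.ofReal p) volume ^ 2 ≤ sobolevSq w := by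
  set l := eLpNorm w (ENNReal.ofReal p) volume with hl
  by_cases h0 : l = 0
  · simp [h0]
  have hinv : ENNReal.ofReal l.toReal⁻¹ = l⁻¹ := by
    rw [ENNReal.ofReal_inv_of_pos (ENNReal.toReal_pos h0 hwp), ENNReal.ofReal_toReal hwp]
  have hpos : 0 ≤ l.toReal⁻¹ := by positivity
  have hone : eLpNorm (fun x => l.toReal⁻¹ * w x) (ENNReal.ofReal p) volume = 1 := by
    rw [eLpNorm_const_mul hpos, hinv, ENNReal.inv_mul_cancel h0 hwp]
  have hmem : MemH1 fun x => l.toReal⁻¹ * w x :=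
    ⟨hw.1.const_mul _, _, hw.hasWeakGradient.const_mul _,
      hw.memLp_weakGradient.const_smul l.toReal⁻¹⟩
  have h : mWhole N p ≤ sobolevSq fun x => l.toReal⁻¹ * w x :=
    sInf_le (mem_image_of_mem sobolevSq (show _ ∈ {u | MemH1 u ∧ _} from ⟨hmem, hone⟩))
  rw [hw.hasWeakGradient.sobolevSq_const_mul hpos, hinv] at h
  calc mWhole N p * l ^ 2 ≤ l⁻¹ ^ 2 * sobolevSq w * l ^ 2 := by gcongr
    _ = (l⁻¹ * l) ^ 2 * sobolevSq w := by ring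
    _ = sobolevSq w := by rw [ENNReal.inv_mul_cancel h0 hwp, one_pow, one_mul]

theorem integrable_norm_sq {F : Type*} [NormedAddCommGroup F] {G : Euc N → F}
    (hG : MemLp G 2 volume) : Integrable fun x => ‖G x‖ ^ 2 :=
  (memLp_two_iff_integrable_sq_norm hG.1).1 hG

theorem integrable_inner_of_memLp {F : Type*} [NormedAddCommGroup F] [InnerProductSpace ℝ F]
    {G H : Euc N → F} (hG : MemLp G 2 volume) (hH : MemLp H 2 volume) :
    Integrable fun x => ⟪G x, H x⟫ := by
  have h := (((integrable_norm_sq (hG.add hH)).sub (integrable_norm_sq hG)).sub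
    (integrable_norm_sq hH)).div_const 2
  refine h.congr (ae_of_all _ fun x => ?_)
  simp only [Pi.sub_apply, Pi.add_apply, norm_add_sq_real]
  ring

theorem HasWeakGradient.sobolevSq_eq_ofReal {u : Euc N → ℝ} {G : Euc N → Euc N}
    (h : HasWeakGradient u G) (hu : MemLp u 2 volume) (hG : MemLp G 2 volume) :
    sobolevSq u = ENNReal.ofReal (∫ x, (‖G x‖ ^ 2 + u x ^ 2)) := by
  have hi : Integrable fun x => ‖G x‖ ^ 2 + u x ^ 2 := (integrable_norm_sq hG).add hu.integrable_sq
  rw [ofReal_integral_eq_lintegral_ofReal hi (ae_of_all _ fun x => by positivity)]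
  refine lintegral_congr_ae ?_
  filter_upwards [h.weakGradient_ae_eq] with x hx
  rw [hx]

/-- A nonnegative minimizer is a weak supersolution. -/
theorem isWeakSupersolution_of_minimizer {p : ℝ} {v : Euc N → ℝ}
    {G : Euc N → Euc N} (hvG : HasWeakGradient v G) (hv : MemLp v 2 volume)
    (hG : MemLp G 2 volume) (hv0 : ∀ x, 0 ≤ v x)
    (hv1 : eLpNorm v (ENNReal.ofReal p) volume = 1) (hmin : sobolevSq v ≤ mWhole N p) :
    IsWeakSupersolution v G := by
  intro φ hφ hφ0
  have hφ2 := hφ.memLp 2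
  have hg2 := hφ.memLp_gradient 2
  set A := ∫ x, (‖G x‖ ^ 2 + v x ^ 2) with hA
  set B := ∫ x, (⟪G x, gradient φ x⟫ + v x * φ x) with hB
  set C := ∫ x, (‖gradient φ x‖ ^ 2 + φ x ^ 2) with hC
  have iA : Integrable fun x => ‖G x‖ ^ 2 + v x ^ 2 := (integrable_norm_sq hG).add hv.integrable_sq
  have iB : Integrable fun x => ⟪G x, gradient φ x⟫ + v x * φ x := by
    refine (integrable_inner_of_memLp hG hg2).add
      ((integrable_inner_of_memLp hv hφ2).congr (ae_of_all _ fun x => ?_))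
    simp [mul_comm]
  have iC : Integrable fun x => ‖gradient φ x‖ ^ 2 + φ x ^ 2 :=
    (integrable_norm_sq hg2).add hφ2.integrable_sq
  have hC0 : 0 ≤ C := integral_nonneg fun x => by positivity
  -- Since v + tφ ≥ v ≥ 0, its L^p norm is at least 1, so minimality of v bounds its squared H^1
  -- norm from below by that of v. Expanding the square gives the claim.
  have key : ∀ t : ℝ, 0 < t → 0 ≤ 2 * t * B + t ^ 2 * C := by
    intro t ht
    have hw := hvG.add ((hasWeakGradient_gradient hφ.1).const_mul t)
    have hw2 : MemLp (fun x => v x + t * φ x) 2 volume := hv.add (hφ2.const_mul t)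
    have hwG : MemLp (fun x => G x + t • gradient φ x) 2 volume := hG.add (hg2.const_smul t)
    have hvp : MemLp v (ENNReal.ofReal p) volume := ⟨hv.1, by simp [hv1]⟩
    have hwp : MemLp (fun x => v x + t * φ x) (ENNReal.ofReal p) volume :=
      hvp.add ((hφ.memLp _).const_mul t)
    have hge : 1 ≤ eLpNorm (fun x => v x + t * φ x) (ENNReal.ofReal p) volume := by
      rw [← hv1]
      refine eLpNorm_mono fun x => ?_
      have : 0 ≤ t * φ x := mul_nonneg ht.le (hφ0 x)
      rw [Real.norm_of_nonneg (hv0 x), Real.norm_of_nonneg (by linarith [hv0 x])]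
      linarith
    have hle : sobolevSq v ≤ sobolevSq fun x => v x + t * φ x :=
      calc sobolevSq v ≤ mWhole N p * 1 := by rwa [mul_one]
        _ ≤ mWhole N p * eLpNorm (fun x => v x + t * φ x) (ENNReal.ofReal p) volume ^ 2 := by
            gcongr
            exact one_le_pow₀ hge
        _ ≤ _ := mWhole_mul_le_sobolevSq ⟨hw2, _, hw, hwG⟩ hwp.2.ne
    rw [hvG.sobolevSq_eq_ofReal hv hG, hw.sobolevSq_eq_ofReal hw2 hwG,
      ENNReal.ofReal_le_ofReal_iff (integral_nonneg fun x => by positivity)] at hle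
    have e : ∫ x, (‖G x + t • gradient φ x‖ ^ 2 + (v x + t * φ x) ^ 2) =
        A + 2 * t * B + t ^ 2 * C := by
      rw [hA, hB, hC, ← integral_const_mul, ← integral_const_mul,
        ← integral_add iA (iB.const_mul _), ← integral_add ?_ (iC.const_mul _)]
      swap
      · exact iA.add (iB.const_mul _)
      refine integral_congr_ae (ae_of_all _ fun x => ?_)
      simp only [norm_add_sq_real, norm_smul, real_inner_smul_right, mul_pow, Real.norm_eq_abs,
        sq_abs]
      ring
    rw [e] at hle
    linarith
  by_contra hneg
  push Not at hneg
  -- If B < 0, this t is positive and small enough for the linear term to win; C + 1 replaces C to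
  -- allow C = 0.
  have h1 := key (-B / (C + 1)) (by apply div_pos <;> linarith)
  have h2 : 2 * (-B / (C + 1)) * B + (-B / (C + 1)) ^ 2 * C
      = -(B / (C + 1)) ^ 2 * (C + 2) := by
    field_simp
    ring
  rw [h2] at h1
  have h3 : 0 < (B / (C + 1)) ^ 2 := by
    have : B / (C + 1) ≠ 0 := div_ne_zero hneg.ne (by linarith)
    positivity
  nlinarith

/-! ### Mollification preserves supersolutions. -/

theorem integrable_mollify_pairing {F : Type*} [NormedAddCommGroup F] [InnerProductSpace ℝ F]
    (n : ℕ) {f g : Euc N → F} (hf : LocallyIntegrable f)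
    (hg : Continuous g) (hgc : HasCompactSupport g) :
    Integrable (fun q : Euc N × Euc N => mollifier N n q.2 * ⟪f (q.1 - q.2), g q.1⟫)
      (volume.prod volume) := by
  obtain ⟨R₁, hR₁⟩ := hgc.isCompact.isBounded.subset_closedBall 0
  obtain ⟨R₂, hR₂⟩ :=
    (hasCompactSupport_mollifier (N := N) n).isCompact.isBounded.subset_closedBall 0
  obtain ⟨C, hC⟩ := hgc.exists_bound_of_continuous hg
  -- Wherever g(y) and the mollifier at t are both nonzero, y - t lies in this ball, so truncating f
  -- to it changes nothing and makes f integrable.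
  have hf' : Integrable ((Metric.closedBall 0 (R₁ + R₂)).indicator f) :=
    (integrable_indicator_iff Metric.isClosed_closedBall.measurableSet).2
      (hf.integrableOn_isCompact (isCompact_closedBall _ _))
  have h1 := (integrable_mollifier (N := N) n).convolution_integrand
    (ContinuousLinearMap.lsmul ℝ ℝ) hf'
  simp only [ContinuousLinearMap.lsmul_apply] at h1
  have h2 := (h1.norm.const_mul C).mono'
    (h1.1.inner (𝕜 := ℝ) (hg.comp continuous_fst).aestronglyMeasurable) (ae_of_all _ fun q => ?_)
  · refine h2.congr (ae_of_all _ fun q => ?_)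
    simp only [Function.comp_apply, real_inner_smul_left]
    by_cases hgq : g q.1 = 0
    · simp [hgq]
    by_cases hηq : mollifier N n q.2 = 0
    · simp [hηq]
    rw [indicator_of_mem]
    have a1 := hR₁ (subset_tsupport g hgq)
    have a2 := hR₂ (subset_tsupport _ hηq)
    rw [mem_closedBall_zero_iff] at a1 a2 ⊢
    exact (norm_sub_le _ _).trans (add_le_add a1 a2)
  · refine (norm_inner_le_norm _ _).trans ?_
    rw [mul_comm]
    gcongr
    exact hC _

theorem integral_inner_mollify {F : Type*} [NormedAddCommGroup F] [InnerProductSpace ℝ F]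
    [CompleteSpace F] (n : ℕ) {f g : Euc N → F} (hf : LocallyIntegrable f)
    (hg : Continuous g) (hgc : HasCompactSupport g) :
    ∫ y, ⟪mollify n f y, g y⟫ = ∫ t, mollifier N n t * ∫ y, ⟪f (y - t), g y⟫ := by
  have hi := integrable_mollify_pairing n hf hg hgc
  have e : ∀ y, ⟪mollify n f y, g y⟫ = ∫ t, mollifier N n t * ⟪f (y - t), g y⟫ := by
    intro y
    have := (innerSL ℝ (g y)).integral_comp_comm (integrable_mollify_integrand n hf y)
    simp only [innerSL_apply_apply, real_inner_smul_right] at this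
    rw [real_inner_comm, mollify, ← this]
    simp only [real_inner_comm]
  simp only [e]
  rw [integral_integral_swap hi]
  simp only [integral_const_mul]

theorem integrable_mollifier_mul_integral {F : Type*} [NormedAddCommGroup F]
    [InnerProductSpace ℝ F] (n : ℕ) {f g : Euc N → F} (hf : LocallyIntegrable f)
    (hg : Continuous g) (hgc : HasCompactSupport g) :
    Integrable (fun t => mollifier N n t * ∫ y, ⟪f (y - t), g y⟫) := by
  have := (integrable_mollify_pairing n hf hg hgc).integral_prod_right
  simpa only [integral_const_mul] using this

theorem integrable_inner_of_locallyIntegrable {F : Type*} [NormedAddCommGroup F]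
    [InnerProductSpace ℝ F] {f g : Euc N → F} (hf : LocallyIntegrable f)
    (hg : Continuous g) (hgc : HasCompactSupport g) : Integrable (fun y => ⟪f y, g y⟫) := by
  obtain ⟨C, hC⟩ := hgc.exists_bound_of_continuous hg
  have h1 := (integrable_indicator_iff (isClosed_tsupport g).measurableSet).2
    (hf.integrableOn_isCompact hgc.isCompact)
  have h2 := (h1.norm.const_mul C).mono' (h1.1.inner (𝕜 := ℝ) hg.aestronglyMeasurable)
    (ae_of_all _ fun y => ?_)
  · refine h2.congr (ae_of_all _ fun y => ?_)
    by_cases hy : g y = 0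
    · simp [hy]
    · simp only [indicator_of_mem (subset_tsupport g hy)]
  · refine (norm_inner_le_norm _ _).trans ?_
    rw [mul_comm]
    gcongr
    exact hC _

/-- The inequality is linear and translation invariant, and a mollification is an average of
translates with nonnegative weights. -/
theorem IsWeakSupersolution.supersolution_mollify {v : Euc N → ℝ} {G : Euc N → Euc N}
    (h : IsWeakSupersolution v G) (hvG : HasWeakGradient v G) (n : ℕ) :
    IsWeakSupersolution (mollify n v) (gradient (mollify n v)) := by
  intro φ hφ hφ0
  have hφc := hasCompactSupport_gradient hφ.2.1
  have loc : ∀ {F : Type} [NormedAddCommGroup F] {f : Euc N → F} (t : Euc N),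
      LocallyIntegrable f → LocallyIntegrable fun y => f (y - t) := by
    intro F _ f t hf
    have h1 := (locallyIntegrable_map_homeomorph (μ := volume) (Homeomorph.subRight t) (f := f)).1
    refine h1 ?_
    have h2 := (measurePreserving_sub_right (volume : Measure (Euc N)) t).map_eq
    rw [Homeomorph.coe_subRight, h2]
    exact hf
  have e : ∀ a b : ℝ, a * b = ⟪a, b⟫ := fun a b => by simp [mul_comm]
  rw [hvG.gradient_mollify, integral_add]
  · simp only [e (mollify n v _)]
    rw [integral_inner_mollify n hvG.2.1 hφ.continuous_gradient hφc,
      integral_inner_mollify n hvG.1 hφ.continuous hφ.2.1, ← integral_add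
      (integrable_mollifier_mul_integral n hvG.2.1 hφ.continuous_gradient hφc)
      (integrable_mollifier_mul_integral n hvG.1 hφ.continuous hφ.2.1)]
    refine integral_nonneg fun t => ?_
    simp only [Pi.zero_apply, ← mul_add]
    refine mul_nonneg (mollifier_nonneg n t) ?_
    have hφt : IsTestFunction univ (fun y => φ (y - -t)) :=
      hφ.comp_sub_right (-t) fun _ _ => mem_univ _
    have h0 := h _ hφt fun x => hφ0 _
    have hgr : ∀ x, gradient (fun y => φ (y + t)) x = gradient φ (x + t) := fun x => by
      simpa using gradient_comp_sub_right φ (-t) x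
    simp only [sub_neg_eq_add, hgr] at h0
    rw [← integral_sub_right_eq_self _ t] at h0
    simp only [sub_add_cancel, e (v _)] at h0
    rwa [integral_add (integrable_inner_of_locallyIntegrable (loc t hvG.2.1)
      hφ.continuous_gradient hφc) (integrable_inner_of_locallyIntegrable (loc t hvG.1)
      hφ.continuous hφ.2.1)] at h0
  · rw [← hvG.gradient_mollify]
    exact integrable_inner_of_locallyIntegrable
      (continuous_gradient (contDiff_mollify n hvG.1)).locallyIntegrable
      hφ.continuous_gradient hφc
  · simp only [e]
    exact integrable_inner_of_locallyIntegrable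
      (contDiff_mollify n hvG.1).continuous.locallyIntegrable hφ.continuous hφ.2.1

/-! ### Radial averages and the mean value inequality. -/

/-- The derivative of `expNegInvGlue`. -/
noncomputable def glueSlope (s : ℝ) : ℝ := s⁻¹ ^ 2 * expNegInvGlue s

theorem hasDerivAt_expNegInvGlue (s : ℝ) : HasDerivAt expNegInvGlue (glueSlope s) s := by
  have h := expNegInvGlue.hasDerivAt_polynomial_eval_inv_mul 1 s
  simpa [glueSlope] using h

theorem continuous_glueSlope : Continuous glueSlope := by
  have h := expNegInvGlue.continuous_polynomial_eval_inv_mul (Polynomial.X ^ 2)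
  simpa only [Polynomial.eval_pow, Polynomial.eval_X] using! h

theorem glueSlope_nonneg (s : ℝ) : 0 ≤ glueSlope s :=
  mul_nonneg (sq_nonneg _) (expNegInvGlue.nonneg s)

theorem expNegInvGlue_le_glueSlope {s : ℝ} (hs : s ≤ 1) : expNegInvGlue s ≤ glueSlope s := by
  rcases le_or_gt s 0 with h | h
  · simp [glueSlope, expNegInvGlue.zero_of_nonpos h]
  · exact le_mul_of_one_le_left (expNegInvGlue.nonneg s)
      (one_le_pow₀ ((one_le_inv₀ h).2 hs))

/-- A radial bump function supported in the unit ball. -/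
noncomputable def radialBump (z : Euc N) : ℝ := expNegInvGlue (1 - ‖z‖ ^ 2)

/-- The averaging kernel: `∇ radialBump z = - radialKernel z • z`. -/
noncomputable def radialKernel (z : Euc N) : ℝ := 2 * glueSlope (1 - ‖z‖ ^ 2)

theorem contDiff_radialBump : ContDiff ℝ ∞ (radialBump (N := N)) :=
  (expNegInvGlue.contDiff (n := ⊤)).comp (contDiff_const.sub (contDiff_norm_sq ℝ))

theorem continuous_radialKernel : Continuous (radialKernel (N := N)) := by
  have := continuous_glueSlope
  unfold radialKernel
  fun_prop

theorem radialBump_nonneg (z : Euc N) : 0 ≤ radialBump z := expNegInvGlue.nonneg _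

theorem radialKernel_nonneg (z : Euc N) : 0 ≤ radialKernel z :=
  mul_nonneg two_pos.le (glueSlope_nonneg _)

theorem radialKernel_pos {z : Euc N} (hz : ‖z‖ < 1) : 0 < radialKernel z := by
  have h : 0 < 1 - ‖z‖ ^ 2 := by nlinarith [norm_nonneg z]
  have := expNegInvGlue.pos_of_pos h
  unfold radialKernel glueSlope
  positivity

/-- Lets the zero-order term w·bump be absorbed into the average of w against the kernel, which
closes the differential inequality for that average. -/
theorem radialBump_le (z : Euc N) : radialBump z ≤ radialKernel z / 2 := by
  have h := expNegInvGlue_le_glueSlope (s := 1 - ‖z‖ ^ 2) (by linarith [sq_nonneg ‖z‖])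
  unfold radialBump radialKernel
  linarith

theorem one_sub_norm_sq_nonpos {z : Euc N} (hz : z ∉ Metric.closedBall (0 : Euc N) 1) :
    1 - ‖z‖ ^ 2 ≤ 0 := by
  rw [mem_closedBall_zero_iff, not_le] at hz
  nlinarith

theorem hasCompactSupport_radialBump : HasCompactSupport (radialBump (N := N)) :=
  HasCompactSupport.intro (isCompact_closedBall 0 1) fun _ hz =>
    expNegInvGlue.zero_of_nonpos (one_sub_norm_sq_nonpos hz)

theorem hasCompactSupport_radialKernel : HasCompactSupport (radialKernel (N := N)) :=
  HasCompactSupport.intro (isCompact_closedBall 0 1) fun _ hz => by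
    simp [radialKernel, glueSlope, expNegInvGlue.zero_of_nonpos (one_sub_norm_sq_nonpos hz)]

theorem gradient_radialBump (z : Euc N) : gradient radialBump z = -(radialKernel z • z) := by
  refine ext_inner_left ℝ fun v => ?_
  have h := (hasDerivAt_expNegInvGlue (1 - ‖z‖ ^ 2)).comp_hasFDerivAt z
    ((hasStrictFDerivAt_norm_sq z).hasFDerivAt.const_sub 1)
  have e : fderiv ℝ radialBump z = glueSlope (1 - ‖z‖ ^ 2) • -(2 • innerSL ℝ z) := h.fderiv
  rw [inner_gradient_right, e, conj_trivial, inner_neg_right, real_inner_smul_right, radialKernel]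
  simp [real_inner_comm v z]
  ring

/-- The bump function centred at `x` at scale `r`. -/
noncomputable def scaledBump (x : Euc N) (r : ℝ) (y : Euc N) : ℝ := radialBump (r⁻¹ • (y - x))

theorem isTestFunction_scaledBump (x : Euc N) {r : ℝ} (hr : 0 < r) :
    IsTestFunction univ (scaledBump x r) := by
  refine ⟨contDiff_radialBump.comp (by fun_prop), ?_,
    subset_univ _⟩
  exact hasCompactSupport_radialBump.comp_homeomorph
    ((Homeomorph.subRight x).trans (Homeomorph.smulOfNeZero r⁻¹ (inv_ne_zero hr.ne')))

theorem gradient_scaledBump (x : Euc N) (r : ℝ) (y : Euc N) :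
    gradient (scaledBump x r) y = r⁻¹ • gradient radialBump (r⁻¹ • (y - x)) := by
  have h1 : fderiv ℝ (scaledBump x r) y =
      fderiv ℝ (fun z : Euc N => radialBump (r⁻¹ • z)) (y - x) :=
    fderiv_comp_sub (f := fun z : Euc N => radialBump (r⁻¹ • z)) x
  have h2 : fderiv ℝ (fun z : Euc N => radialBump (r⁻¹ • z)) (y - x) =
      r⁻¹ • fderiv ℝ radialBump (r⁻¹ • (y - x)) := fderiv_comp_smul (f := radialBump) _
  rw [gradient, gradient, h1, h2, map_smul]

/-- The weighted average of `w` around `x` at scale `r`. -/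
noncomputable def radialAverage (w : Euc N → ℝ) (x : Euc N) (r : ℝ) : ℝ :=
  ∫ z, radialKernel z * w (x + r • z)

theorem integrable_kernel_mul {f : Euc N → ℝ} (hf : Continuous f) :
    Integrable fun z => radialKernel z * f z :=
  (continuous_radialKernel.mul hf).integrable_of_hasCompactSupport
    hasCompactSupport_radialKernel.mul_right

theorem hasDerivAt_radialAverage {w : Euc N → ℝ} (hw : ContDiff ℝ ∞ w) (x : Euc N) (r : ℝ) :
    HasDerivAt (radialAverage w x)
      (∫ z, radialKernel z * ⟪gradient w (x + r • z), z⟫) r := by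
  have hg := continuous_gradient hw
  obtain ⟨C, hC⟩ := (isCompact_closedBall x (|r| + 1)).exists_bound_of_continuousOn hg.continuousOn
  have hcont : ∀ s : ℝ, Continuous fun z : Euc N => w (x + s • z) := fun s =>
    hw.continuous.comp (by fun_prop)
  refine (hasDerivAt_integral_of_dominated_loc_of_deriv_le (Metric.ball_mem_nhds r one_pos)
    (F := fun s z => radialKernel z * w (x + s • z))
    (F' := fun s z => radialKernel z * ⟪gradient w (x + s • z), z⟫)
    (bound := fun z => radialKernel z * C)
    (Eventually.of_forall fun s => (integrable_kernel_mul (hcont s)).1)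
    (integrable_kernel_mul (hcont r)) ?_ (ae_of_all _ fun z s hs => ?_)
    (integrable_kernel_mul continuous_const) (ae_of_all _ fun z s hs => ?_)).2
  · exact (integrable_kernel_mul ((hg.comp (by fun_prop : Continuous fun z : Euc N =>
      x + r • z)).inner continuous_id)).1
  · by_cases hz : z ∈ Metric.closedBall (0 : Euc N) 1
    · rw [norm_mul, Real.norm_of_nonneg (radialKernel_nonneg z)]
      rw [mem_closedBall_zero_iff] at hz
      refine mul_le_mul_of_nonneg_left ?_ (radialKernel_nonneg z)
      have hs' : |s| ≤ |r| + 1 := by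
        have h1 : |s - r| < 1 := by simpa [Real.dist_eq] using hs
        have h2 := abs_add_le (s - r) r
        rw [sub_add_cancel] at h2
        linarith
      have h3 := hC (x + s • z) (by
        rw [Metric.mem_closedBall, dist_eq_norm, add_sub_cancel_left, norm_smul, Real.norm_eq_abs]
        nlinarith [abs_nonneg s, norm_nonneg z])
      refine (norm_inner_le_norm _ _).trans ?_
      nlinarith [norm_nonneg z, norm_nonneg (gradient w (x + s • z))]
    · have : radialKernel z = 0 := by
        simp [radialKernel, glueSlope, expNegInvGlue.zero_of_nonpos (one_sub_norm_sq_nonpos hz)]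
      simp [this]
  · refine HasDerivAt.const_mul _ ?_
    have h1 : HasFDerivAt w (fderiv ℝ w (x + s • z)) (x + s • z) :=
      (hw.differentiable (by simp) _).hasFDerivAt
    have h2 : HasDerivAt (fun s : ℝ => x + s • z) z s := by
      simpa using ((hasDerivAt_id s).smul_const z).const_add x
    have h3 := h1.comp_hasDerivAt s h2
    rwa [← inner_gradient_left] at h3

/-- Testing with the bump at scale r, whose gradient is minus the kernel times z/r, turns the
gradient term into -1/r times the derivative of the average. -/
theorem deriv_radialAverage_le {w : Euc N → ℝ} (hw : ContDiff ℝ ∞ w) (hw0 : ∀ x, 0 ≤ w x)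
    (hs : IsWeakSupersolution w (gradient w)) (x : Euc N) {r : ℝ} (hr : 0 < r) :
    ∫ z, radialKernel z * ⟪gradient w (x + r • z), z⟫ ≤ r / 2 * radialAverage w x r := by
  have h0 := hs _ (isTestFunction_scaledBump x hr) fun y => radialBump_nonneg _
  set I : Euc N → ℝ := fun y =>
    ⟪gradient w y, gradient (scaledBump x r) y⟫ + w y * scaledBump x r y with hI
  have h1 : 0 ≤ ∫ z, I (x + r • z) := by
    rw [Measure.integral_comp_smul (μ := volume) (fun z => I (x + z)) r,
      integral_add_left_eq_self I x]
    exact smul_nonneg (abs_nonneg _) h0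
  have hcont : Continuous fun z : Euc N => w (x + r • z) := hw.continuous.comp (by fun_prop)
  have hgc : Continuous fun z : Euc N => gradient w (x + r • z) :=
    (continuous_gradient hw).comp (by fun_prop)
  have e : ∀ z, I (x + r • z) = w (x + r • z) * radialBump z
      - r⁻¹ * (radialKernel z * ⟪gradient w (x + r • z), z⟫) := by
    intro z
    have hrz : r⁻¹ • r • z = z := inv_smul_smul₀ hr.ne' z
    simp only [hI, gradient_scaledBump, scaledBump, add_sub_cancel_left, hrz]
    simp only [gradient_radialBump, smul_neg, inner_neg_right, real_inner_smul_right]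
    ring
  have i1 : Integrable fun z => w (x + r • z) * radialBump z :=
    (hcont.mul contDiff_radialBump.continuous).integrable_of_hasCompactSupport
      hasCompactSupport_radialBump.mul_left
  have i2 := integrable_kernel_mul (hgc.inner (𝕜 := ℝ) continuous_id)
  simp only [id_eq] at i2
  simp only [e] at h1
  rw [integral_sub i1 (i2.const_mul _), integral_const_mul] at h1
  have h2 : ∫ z, w (x + r • z) * radialBump z ≤ radialAverage w x r / 2 := by
    rw [radialAverage, ← integral_div]
    refine integral_mono i1 ((integrable_kernel_mul hcont).div_const 2) fun z => ?_
    have := mul_le_mul_of_nonneg_left (radialBump_le z) (hw0 (x + r • z))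
    simp only
    linarith
  have h3 : r⁻¹ * (∫ z, radialKernel z * ⟪gradient w (x + r • z), z⟫)
      ≤ radialAverage w x r / 2 := by linarith
  rw [inv_mul_le_iff₀ hr] at h3
  linarith

/-- The mean value inequality for smooth nonnegative supersolutions of `-Δw + w = 0`. -/
theorem radialAverage_le {w : Euc N → ℝ} (hw : ContDiff ℝ ∞ w) (hw0 : ∀ x, 0 ≤ w x)
    (hs : IsWeakSupersolution w (gradient w)) (x : Euc N) {r : ℝ} (hr : 0 ≤ r) :
    radialAverage w x r ≤ Real.exp (r ^ 2 / 4) * (w x * ∫ z : Euc N, radialKernel z) := by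
  have hd := hasDerivAt_radialAverage hw x
  -- The factor exp(-s²/4) integrates A' ≤ (s/2)A, so the product is nonincreasing on [0, ∞).
  have hD : ∀ s, HasDerivAt (fun s => Real.exp (-(s ^ 2 / 4)) * radialAverage w x s)
      (Real.exp (-(s ^ 2 / 4)) * ((∫ z, radialKernel z * ⟪gradient w (x + s • z), z⟫)
        - s / 2 * radialAverage w x s)) s := by
    intro s
    have h1 : HasDerivAt (fun s : ℝ => Real.exp (-(s ^ 2 / 4)))
        (Real.exp (-(s ^ 2 / 4)) * -(s / 2)) s := by
      have h := (((hasDerivAt_pow 2 s).div_const 4).fun_neg).exp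
      convert h using 2
      push_cast
      ring
    refine (h1.mul (hd s)).congr_deriv ?_
    ring
  have hanti : AntitoneOn (fun s => Real.exp (-(s ^ 2 / 4)) * radialAverage w x s) (Ici 0) := by
    refine antitoneOn_of_deriv_nonpos (convex_Ici 0)
      (fun s _ => (hD s).continuousAt.continuousWithinAt)
      (fun s _ => (hD s).differentiableAt.differentiableWithinAt) fun s hs' => ?_
    rw [interior_Ici] at hs'
    rw [(hD s).deriv]
    exact mul_nonpos_of_nonneg_of_nonpos (Real.exp_pos _).le
      (sub_nonpos.2 (deriv_radialAverage_le hw hw0 hs x hs'))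
  have h := hanti (mem_Ici.2 le_rfl) (mem_Ici.2 hr) hr
  have e0 : radialAverage w x 0 = w x * ∫ z : Euc N, radialKernel z := by
    simp only [radialAverage, zero_smul, add_zero, integral_mul_const, mul_comm (w x)]
  simp only [e0] at h
  rw [Real.exp_neg, inv_mul_le_iff₀ (Real.exp_pos _)] at h
  simpa using h

/-! ### The strong maximum principle. -/

theorem quasiMeasurePreserving_add_smul (x : Euc N) {r : ℝ} (hr : r ≠ 0) :
    Measure.QuasiMeasurePreserving (fun z : Euc N => x + r • z) volume volume :=
  (measurePreserving_add_left volume x).quasiMeasurePreserving.comp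
    (Measure.quasiMeasurePreserving_smul volume hr)

theorem quasiMeasurePreserving_smul_sub (x : Euc N) {r : ℝ} (hr : r ≠ 0) :
    Measure.QuasiMeasurePreserving (fun y : Euc N => r⁻¹ • (y - x)) volume volume :=
  (Measure.quasiMeasurePreserving_smul volume (inv_ne_zero hr)).comp
    (measurePreserving_sub_right volume x).quasiMeasurePreserving

/-- The strong maximum principle: a nonnegative weak supersolution of `-Δv + v = 0` that vanishes
on a set of positive measure vanishes almost everywhere. -/
theorem IsWeakSupersolution.ae_eq_zero {v : Euc N → ℝ} {G : Euc N → Euc N}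
    (h : IsWeakSupersolution v G) (hvG : HasWeakGradient v G) (hv0 : ∀ x, 0 ≤ v x)
    (hz : ∃ᵐ x, v x = 0) : v =ᵐ[volume] 0 := by
  have hconv := ae_tendsto_mollify hvG.1
  -- Positive measure of the zero set yields a zero of v at which the mollifications converge to v,
  -- hence to 0.
  obtain ⟨x, hvx, hx⟩ := (hz.and_eventually hconv).exists
  rw [hvx] at hx
  have main : ∀ r : ℝ, 0 < r → ∀ᵐ y, ‖y - x‖ < r → v y = 0 := by
    intro r hr
    have hcz : ∀ᵐ z, Tendsto (fun n => mollify n v (x + r • z)) atTop (𝓝 (v (x + r • z))) :=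
      (quasiMeasurePreserving_add_smul x hr.ne').ae hconv
    have hsm := fun n => contDiff_mollify n hvG.1
    have hcont : ∀ n, Continuous fun z : Euc N => mollify n v (x + r • z) := fun n =>
      (hsm n).continuous.comp (by fun_prop)
    have hbound : ∀ n, ∫⁻ z, ENNReal.ofReal (radialKernel z * mollify n v (x + r • z)) ≤
        ENNReal.ofReal (Real.exp (r ^ 2 / 4) *
          (mollify n v x * ∫ z : Euc N, radialKernel z)) := by
      intro n
      rw [← ofReal_integral_eq_lintegral_ofReal (integrable_kernel_mul (hcont n))
        (ae_of_all _ fun z => mul_nonneg (radialKernel_nonneg z) (mollify_nonneg n hv0 _))]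
      exact ENNReal.ofReal_le_ofReal
        (radialAverage_le (hsm n) (mollify_nonneg n hv0) (h.supersolution_mollify hvG n) x hr.le)
    have hlim : Tendsto (fun n => ENNReal.ofReal (Real.exp (r ^ 2 / 4) *
          (mollify n v x * ∫ z : Euc N, radialKernel z))) atTop (𝓝 0) := by
      have := ENNReal.tendsto_ofReal
        ((hx.mul_const (∫ z : Euc N, radialKernel z)).const_mul (Real.exp (r ^ 2 / 4)))
      simpa using this
    have hmeas : ∀ n, Measurable fun z : Euc N =>
        ENNReal.ofReal (radialKernel z * mollify n v (x + r • z)) := fun n =>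
      (continuous_radialKernel.mul (hcont n)).measurable.ennreal_ofReal
    -- Fatou's lemma: the averages around x are bounded by multiples of the mollifications at x,
    -- which tend to 0.
    have hzero : ∫⁻ z, liminf (fun n =>
        ENNReal.ofReal (radialKernel z * mollify n v (x + r • z))) atTop = 0 := by
      refine le_antisymm ((lintegral_liminf_le hmeas).trans ?_) zero_le
      rw [← hlim.liminf_eq]
      exact liminf_le_liminf (Eventually.of_forall hbound)
    rw [lintegral_eq_zero_iff (Measurable.liminf hmeas)] at hzero
    have hz0 : ∀ᵐ z : Euc N, ‖z‖ < 1 → v (x + r • z) = 0 := by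
      filter_upwards [hzero, hcz] with z h1 h2 hz1
      have h3 := ENNReal.tendsto_ofReal (h2.const_mul (radialKernel z))
      rw [h3.liminf_eq] at h1
      have h4 : radialKernel z * v (x + r • z) ≤ 0 := by simpa using h1
      exact le_antisymm (nonpos_of_mul_nonpos_right h4 (radialKernel_pos hz1)) (hv0 _)
    filter_upwards [(quasiMeasurePreserving_smul_sub x hr.ne').ae hz0] with y hy hyr
    rw [smul_inv_smul₀ hr.ne', add_sub_cancel] at hy
    refine hy ?_
    rwa [norm_smul, norm_inv, Real.norm_of_nonneg hr.le, inv_mul_lt_iff₀ hr, mul_one]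
  have hall : ∀ᵐ y, ∀ n : ℕ, ‖y - x‖ < (n : ℝ) + 1 → v y = 0 :=
    ae_all_iff.2 fun n => main _ (by positivity)
  filter_upwards [hall] with y hy
  obtain ⟨n, hn⟩ := exists_nat_gt ‖y - x‖
  exact hy n (by linarith)

/-! ### Non-attainment. -/

theorem energy_eq {α : Euc N → ℝ} (hαm : AEStronglyMeasurable α volume) (hα : ∀ᵐ x, 0 ≤ α x)
    {u : Euc N → ℝ} (hu : MemH1 u) :
    energy α u = sobolevSq u + ∫⁻ x, ENNReal.ofReal (α x * u x ^ 2) := by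
  rw [sobolevSq, ← lintegral_add_right']
  · refine lintegral_congr_ae ?_
    filter_upwards [hα] with x hx
    rw [← ENNReal.ofReal_add (by positivity) (by positivity)]
    congr 1
    ring
  · exact (hαm.aemeasurable.mul (hu.1.1.aemeasurable.pow_const 2)).ennreal_ofReal

theorem MemH1.sobolevSq_ne_top {u : Euc N → ℝ} (hu : MemH1 u) : sobolevSq u ≠ ⊤ := by
  rw [hu.hasWeakGradient.sobolevSq_eq_ofReal hu.1 hu.memLp_weakGradient]
  exact ENNReal.ofReal_ne_top

/-- A minimizer over the whole space vanishes only on a null set. -/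
theorem ae_ne_zero_of_minimizer {p : ℝ} {u : Euc N → ℝ} (hu : MemH1 u)
    (hu1 : eLpNorm u (ENNReal.ofReal p) volume = 1) (hmin : sobolevSq u ≤ mWhole N p) :
    ∀ᵐ x, u x ≠ 0 := by
  by_contra hcon
  have hv1 : eLpNorm (fun x => |u x|) (ENNReal.ofReal p) volume = 1 := by
    rw [← hu1]
    exact eLpNorm_norm u
  have hs := isWeakSupersolution_of_minimizer hu.hasWeakGradient_abs hu.1.abs hu.memLp_abs_grad
    (fun x => abs_nonneg _) hv1 (hu.sobolevSq_abs_le.trans hmin)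
  have h0 := hs.ae_eq_zero hu.hasWeakGradient_abs (fun x => abs_nonneg _) fun h =>
    hcon (h.mono fun x hx hux => hx (by simp [hux]))
  rw [eLpNorm_congr_ae h0, eLpNorm_zero] at hv1
  exact zero_ne_one hv1

theorem not_exists_energy_eq {Ω : Set (Euc N)} {p ε : ℝ} {α : Euc N → ℝ}
    (hαm : AEStronglyMeasurable α volume) (hα : ∀ᵐ x, 0 ≤ α x) (hα0 : ¬ α =ᵐ[volume] 0)
    (hm : mEps Ω α p ε = mWhole N p) :
    ¬ ∃ u ∈ constraintSet Ω p ε, energy α u = mEps Ω α p ε := by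
  rintro ⟨u, ⟨⟨hu, -⟩, hu1⟩, hE⟩
  rw [hm] at hE
  have hle : mWhole N p ≤ sobolevSq u :=
    sInf_le (mem_image_of_mem sobolevSq
      (show u ∈ {u | MemH1 u ∧ eLpNorm u (ENNReal.ofReal p) volume = 1} from ⟨hu, hu1⟩))
  have hmin : sobolevSq u ≤ mWhole N p := (sobolevSq_le_energy hα u).trans hE.le
  -- Energy and squared H^1 norm of u both equal m; this common value is finite, so it cancels and
  -- leaves no room for the potential term.
  have hzero : ∫⁻ x, ENNReal.ofReal (α x * u x ^ 2) = 0 := by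
    rw [energy_eq hαm hα hu, ← le_antisymm hmin hle] at hE
    exact (ENNReal.add_right_inj hu.sobolevSq_ne_top).1 (hE.trans (add_zero _).symm)
  have hmeas : AEMeasurable (fun x => ENNReal.ofReal (α x * u x ^ 2)) volume :=
    (hαm.aemeasurable.mul (hu.1.1.aemeasurable.pow_const 2)).ennreal_ofReal
  rw [lintegral_eq_zero_iff' hmeas] at hzero
  refine hα0 ?_
  filter_upwards [hzero, hα, ae_ne_zero_of_minimizer hu hu1 hmin] with x h1 h2 h3
  have h4 : α x * u x ^ 2 ≤ 0 := by simpa using h1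
  exact le_antisymm (nonpos_of_mul_nonpos_left h4 (by positivity)) h2

end Concentrating

theorem proposition2p1 (N : ℕ) (hN : 2 ≤ N)
    (p : ℝ) (hp : 2 < p) (hpN : 3 ≤ N → p < 2 * (N : ℝ) / ((N : ℝ) - 2))
    (Ω : Set (EuclideanSpace ℝ (Fin N))) (hΩ_open : IsOpen Ω) (hΩ_conn : IsConnected Ω)
    (hΩ_unbdd : ¬ Bornology.IsBounded Ω) (hΩ_zero : (0 : EuclideanSpace ℝ (Fin N)) ∈ Ω)
    (hΩ_C1 : Concentrating.EnlargesAtInfinity Ω)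
    (α : EuclideanSpace ℝ (Fin N) → ℝ)
    (hα_mem : MeasureTheory.MemLp α ((N : ENNReal) / 2) MeasureTheory.volume)
    (hα_nonneg : ∀ᵐ x, 0 ≤ α x)
    (hα_pos : 0 < MeasureTheory.eLpNorm α ((N : ENNReal) / 2) MeasureTheory.volume)
    (hα_decay : ∃ σ : ℝ, 1 < σ ∧ σ ≤ 2 ∧ MeasureTheory.Integrable (fun x =>
      α x * Real.exp (2 * ‖x‖) * (1 + ‖x‖ ^ (((N : ℝ) - 1) / 2 * σ)))) :
    ∀ ε : ℝ, 0 < ε →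
      Concentrating.mEps Ω α p ε = Concentrating.mWhole N p ∧
      ¬ ∃ u ∈ Concentrating.constraintSet Ω p ε,
        Concentrating.energy α u = Concentrating.mEps Ω α p ε := by

  intro ε hε
  obtain ⟨σ, -, -, hσ⟩ := hα_decay
  have hαi := Concentrating.integrable_of_weighted hα_mem.1 hσ
  have heq : Concentrating.mEps Ω α p ε = Concentrating.mWhole N p :=
    le_antisymm (Concentrating.mEps_le_mWhole hΩ_unbdd hΩ_C1 hαi hε (by linarith))
      (Concentrating.mWhole_le_mEps hα_nonneg)
  refine ⟨heq, Concentrating.not_exists_energy_eq hα_mem.1 hα_nonneg (fun h0 => ?_) heq⟩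
  rw [eLpNorm_congr_ae h0, eLpNorm_zero] at hα_pos
  exact lt_irrefl _ hα_pos
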